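/- Let $\Omega\subset\mathbb{C}$ be a region: $\Omega$ is connected and its interior is a nonempty connected open set ($\Omega$ may contain part of its boundary). Let $\mathbb{H}(\Omega)$ be the integral domain of functions holomorphic on a neighbourhood of $\Omega$, let $\mathbb{M}(\Omega)$ be the field of functions meromorphic on a neighbourhood of $\Omega$, and let $\mathrm{nrank}$ denote the rank over $\mathbb{M}(\Omega)$. For $A,B\in\mathbb{M}(\Omega)^{m\times n}$ write $A\sim_\Omega B$ if $A=EBF$ with $E\in \mathrm{GL}_m(\mathbb{H}(\Omega))$, $F\in \mathrm{GL}_n(\mathbb{H}(\Omega))$. The Smith form of $A\in\mathbb{H}(\Omega)^{m\times n}$ with $\mathrm{nrank}(A)=r$ is $\mathrm{diag}(\phi_1,\dots,\phi_r)\oplus 0_{m-r,n-r}\sim_\Omega A$, where the $\phi_j\in\mathbb{H}(\Omega)$ are nonzero and $\phi_i\mid\phi_j$ for $i\le j$. The Smith–McMillan form of $M\in\mathbb{M}(\Omega)^{m\times n}$ with $\mathrm{nrank}(M)=r$ is $\mathrm{diag}(\phi_1/\psi_1,\dots,\phi_r/\psi_r)\oplus 0_{m-r,n-r}\sim_\Omega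 M$, where the $\phi_j,\psi_j\in\mathbb{H}(\Omega)$ are nonzero, $\phi_i\mid\phi_j$ and $\psi_j\mid\psi_i$ for $i\le j$, and $\phi_j,\psi_j$ are relatively prime. These functions are unique up to units of $\mathbb{H}(\Omega)$. For a point $\lambda$ the zero index is $\mathrm{Ind}_e(\lambda,\cdot)=(\mathrm{ord}_\lambda\phi_1,\dots,\mathrm{ord}_\lambda\phi_r)$ and the pole index is $\mathrm{Ind}_p(\lambda,M)=(\mathrm{ord}_\lambda\psi_1,\dots,\mathrm{ord}_\lambda\psi_r)$. The set of eigenvalues of $A\in\mathbb{H}(\Omega)^{m\times n}$ is $\sigma_\Omega(A)=\{\lambda\in\Omega:\mathrm{rank}\,A(\lambda)<\mathrm{nrank}(A)\}$. For $M\in\mathbb{M}(\Omega)^{m\times n}$ let $\wp_\Omega(M)$ be the set of its poles in $\Omega$. The set $\sigma_\Omega(M)$ of zeros of $M$ consists of the $\lambda\in\Omega\setminus\wp_\Omega(M)$ with $\mathrm{rank}\,M(\lambda)<\mathrm{nrank}(M)$, together with the eigenpoles of $M$, that is, the $\mu\in\wp_\Omega(M)$ for which there is $f\in\mathbb{H}(\Omega)^n$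 such that $\lim_{z\to\mu}M(z)f(z)=0$ and $f(\mu)\ne v(\mu)$ for every $v\in\mathbb{H}(\Omega)^n$ with $Mv=0$ (in particular $f(\mu)\neq 0$ and $Mf\ne0$). A right coprime MFD of $M$ is a factorization $M=ND^{-1}$ with $N\in\mathbb{H}(\Omega)^{m\times n}$, $D\in\mathbb{H}(\Omega)^{n\times n}$, $\mathrm{nrank}(D)=n$, and $\mathrm{rank}\begin{bmatrix}N(z)\\D(z)\end{bmatrix}=n$ for all $z\in\Omega$. **Theorem.** Let $M\in\mathbb{M}(\Omega)^{m\times n}$ have the Smith–McMillan form $\mathrm{diag}(\phi_1/\psi_1,\dots,\phi_r/\psi_r)\oplus 0_{m-r,n-r}$ and let $M=ND^{-1}$ be a right coprime MFD. Then $\mathrm{diag}(\phi_1,\dots,\phi_r)\oplus 0_{m-r,n-r}$ is the Smith form of $N$ and $I_{n-r}\oplus\mathrm{diag}(\psi_r,\psi_{r-1},\dots,\psi_1)$ is the Smith form of $D$. In particular, $$\sigma_\Omega(M)=\sigma_\Omega(N)=\{\lambda\in\Omega:\phi_1(\lambda)\cdots\phi_r(\lambda)=0\},\qquad \mathrm{Ind}_e(\lambda,M)=\mathrm{Ind}_e(\lambda,N)\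 \text{ for }\lambda\in\sigma_\Omega(M),$$ $$\wp_\Omega(M)=\sigma_\Omega(D),\qquad \mathrm{Ind}_e(\lambda,D)=(\underbrace{0,\dots,0}_{n-r},\kappa_r,\dots,\kappa_1)\ \text{ where }(\kappa_1,\dots,\kappa_r)=\mathrm{Ind}_p(\lambda,M),\ \text{ for }\lambda\in\wp_\Omega(M).$$ -/

import Mathlib

open Filter Topology

namespace MeroMat

/-- A region of the complex plane: a set whose interior is a domain (nonempty and connected) and
which may contain part of its boundary. The set itself is connected, so that the holomorphic
functions on it form an integral domain. -/
structure Region where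
  carrier : Set ℂ
  isConnected_interior : IsConnected (interior carrier)
  isConnected : IsConnected carrier

/-- The filter of punctured neighbourhoods of all points of a set: two functions agree eventually
along it iff they agree on a punctured neighbourhood of every point of the set. -/
noncomputable def puncturedNhds (S : Set ℂ) : Filter ℂ := ⨆ z ∈ S, 𝓝[≠] z

/-- The meromorphic functions on `Ω`. A function that is meromorphic at every point of `Ω` is
meromorphic on an open set containing `Ω`; two such functions are identified when they agree near
every point of `Ω`, up to their values at isolated points. -/
noncomputable def merSubring (Ω : Region) : Subring (Germ (puncturedNhds Ω.carrier) ℂ) where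
  carrier := {g | ∃ f : ℂ → ℂ, MeromorphicOn f Ω.carrier ∧ (f : Germ (puncturedNhds Ω.carrier) ℂ) = g}
  mul_mem' := by
    rintro _ _ ⟨f, hf, rfl⟩ ⟨g, hg, rfl⟩
    exact ⟨f * g, fun z hz => (hf z hz).mul (hg z hz), rfl⟩
  one_mem' := ⟨1, fun z _ => MeromorphicAt.const 1 z, rfl⟩
  add_mem' := by
    rintro _ _ ⟨f, hf, rfl⟩ ⟨g, hg, rfl⟩
    exact ⟨f + g, fun z hz => (hf z hz).add (hg z hz), rfl⟩
  zero_mem' := ⟨0, fun z _ => MeromorphicAt.const 0 z, rfl⟩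
  neg_mem' := by
    rintro _ ⟨f, hf, rfl⟩
    exact ⟨-f, fun z hz => (hf z hz).neg, rfl⟩

/-- The ring `𝕄(Ω)` of meromorphic functions on `Ω`. -/
abbrev Mer (Ω : Region) : Type := merSubring Ω

namespace Mer

variable {Ω : Region}

/-- The element of `𝕄(Ω)` given by a meromorphic function. -/
noncomputable def mk (f : ℂ → ℂ) (hf : MeromorphicOn f Ω.carrier) : Mer Ω :=
  ⟨(f : Germ (puncturedNhds Ω.carrier) ℂ), f, hf, rfl⟩

/-- A meromorphic function representing an element of `𝕄(Ω)`. -/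
noncomputable def rep (f : Mer Ω) : ℂ → ℂ := f.2.choose

theorem rep_meromorphicOn (f : Mer Ω) : MeromorphicOn f.rep Ω.carrier := f.2.choose_spec.1

theorem mk_rep (f : Mer Ω) : mk f.rep f.rep_meromorphicOn = f := Subtype.ext f.2.choose_spec.2

theorem mk_eq_mk_iff {f g : ℂ → ℂ} {hf : MeromorphicOn f Ω.carrier}
    {hg : MeromorphicOn g Ω.carrier} :
    (mk f hf : Mer Ω) = mk g hg ↔ ∀ z ∈ Ω.carrier, f =ᶠ[𝓝[≠] z] g := by
  have h : ((f : Germ (puncturedNhds Ω.carrier) ℂ) = g) ↔ ∀ z ∈ Ω.carrier, f =ᶠ[𝓝[≠] z] g := by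
    rw [Germ.coe_eq]
    simp only [puncturedNhds, EventuallyEq, eventually_iSup]
  exact Subtype.ext_iff.trans h

theorem rep_mk (f : ℂ → ℂ) (hf : MeromorphicOn f Ω.carrier) {z : ℂ} (hz : z ∈ Ω.carrier) :
    (mk f hf : Mer Ω).rep =ᶠ[𝓝[≠] z] f :=
  mk_eq_mk_iff.1 (mk_rep (mk f hf)) z hz

noncomputable instance : Inv (Mer Ω) :=
  ⟨fun f => mk f.rep⁻¹ fun z hz => (f.rep_meromorphicOn z hz).inv⟩

/-- `𝕄(Ω)` is a field. -/
noncomputable instance : Field (Mer Ω) where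
  inv := Inv.inv
  exists_pair_ne := by
    refine ⟨mk 0 (fun z _ => MeromorphicAt.const 0 z), mk 1 (fun z _ => MeromorphicAt.const 1 z),
      fun h => ?_⟩
    obtain ⟨z, hz⟩ := Ω.isConnected.nonempty
    obtain ⟨w, hw⟩ := (mk_eq_mk_iff.1 h z hz).exists
    simp at hw
  mul_inv_cancel := by
    intro f hf
    have hne : ∀ z ∈ Ω.carrier, meromorphicOrderAt f.rep z ≠ ⊤ := by
      by_contra! hcon
      obtain ⟨z, hz, hzt⟩ := hcon
      apply hf
      rw [← mk_rep f]
      suffices key : ∀ w ∈ Ω.carrier, f.rep =ᶠ[𝓝[≠] w] 0 from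
        mk_eq_mk_iff (hg := fun z _ => MeromorphicAt.const 0 z).2 key
      intro w hw
      have hwt : meromorphicOrderAt f.rep w = ⊤ := by
        by_contra hwt
        exact f.rep_meromorphicOn.meromorphicOrderAt_ne_top_of_isPreconnected
          Ω.isConnected.isPreconnected hw hz hwt hzt
      exact meromorphicOrderAt_eq_top_iff.1 hwt
    have key : mk (f.rep * f.rep⁻¹) (fun z hz => (f.rep_meromorphicOn z hz).mul
        (f.rep_meromorphicOn z hz).inv) = (1 : Mer Ω) := by
      suffices key : ∀ w ∈ Ω.carrier, f.rep * f.rep⁻¹ =ᶠ[𝓝[≠] w] 1 from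
        mk_eq_mk_iff (hg := fun z _ => MeromorphicAt.const 1 z).2 key
      intro w hw
      filter_upwards [(meromorphicOrderAt_ne_top_iff_eventually_ne_zero
        (f.rep_meromorphicOn w hw)).1 (hne w hw)] with x hx
      simp [hx]
    calc f * f⁻¹ = mk f.rep f.rep_meromorphicOn * f⁻¹ := by rw [mk_rep]
      _ = 1 := key
  inv_zero := by
    suffices key : ∀ w ∈ Ω.carrier, (0 : Mer Ω).rep⁻¹ =ᶠ[𝓝[≠] w] 0 by
      exact mk_eq_mk_iff (hg := fun z _ => MeromorphicAt.const 0 z).2 key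
    intro w hw
    filter_upwards [rep_mk (Ω := Ω) 0 (fun z _ => MeromorphicAt.const 0 z) hw] with x hx
    have hx' : (0 : Mer Ω).rep x = 0 := hx
    simp [hx']
  nnqsmul := _
  nnqsmul_def := fun _ _ => rfl
  qsmul := _
  qsmul_def := fun _ _ => rfl

/-- The point `w` is a pole of `f`. -/
def IsPole (f : Mer Ω) (w : ℂ) : Prop := meromorphicOrderAt f.rep w < 0

/-- The principal divisor of `f` at `w`: the order of `w` as a zero of `f`, or minus its order as a
pole of `f`. -/
noncomputable def divisor (f : Mer Ω) (w : ℂ) : ℤ := (meromorphicOrderAt f.rep w).untop₀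

/-- The value `f(w) = lim_{z → w} f(z)` at a point `w` of `Ω` that is not a pole of `f`. -/
noncomputable def value (f : Mer Ω) (w : ℂ) : ℂ := limUnder (𝓝[≠] w) f.rep

theorem value_mk (f : ℂ → ℂ) (hf : MeromorphicOn f Ω.carrier) {w : ℂ} (hw : w ∈ Ω.carrier)
    (hc : ContinuousAt f w) : (mk f hf : Mer Ω).value w = f w :=
  ((hc.tendsto.mono_left nhdsWithin_le_nhds).congr' (rep_mk f hf hw).symm).limUnder_eq

/-- The function `f` tends to `0` at `w`. -/
def TendstoZero (f : Mer Ω) (w : ℂ) : Prop := Tendsto f.rep (𝓝[≠] w) (𝓝 0)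

end Mer

/-- The ring `ℍ(Ω)` of holomorphic functions on `Ω`, as a subring of `𝕄(Ω)`: the functions that are
analytic at every point of `Ω`, that is, holomorphic on an open set containing `Ω`. -/
noncomputable def holSubring (Ω : Region) : Subring (Mer Ω) where
  carrier := {g | ∃ (f : ℂ → ℂ) (hf : AnalyticOnNhd ℂ f Ω.carrier), Mer.mk f hf.meromorphicOn = g}
  mul_mem' := by
    rintro _ _ ⟨f, hf, rfl⟩ ⟨g, hg, rfl⟩
    exact ⟨f * g, hf.mul hg, rfl⟩
  one_mem' := ⟨1, fun _ _ => analyticAt_const, rfl⟩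
  add_mem' := by
    rintro _ _ ⟨f, hf, rfl⟩ ⟨g, hg, rfl⟩
    exact ⟨f + g, hf.add hg, rfl⟩
  zero_mem' := ⟨0, fun _ _ => analyticAt_const, rfl⟩
  neg_mem' := by
    rintro _ ⟨f, hf, rfl⟩
    exact ⟨-f, hf.neg, rfl⟩

/-- The ring `ℍ(Ω)` of holomorphic functions on `Ω`. -/
abbrev Hol (Ω : Region) : Type := holSubring Ω

section Matrices

variable {Ω : Region} {m n r : ℕ}

/-- A holomorphic matrix regarded as a meromorphic matrix. -/
def toMer (A : Matrix (Fin m) (Fin n) (Hol Ω)) : Matrix (Fin m) (Fin n) (Mer Ω) :=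
  A.map fun f => (f : Mer Ω)

/-- The complex matrix `M(w)`, for a point `w` of `Ω` that is not a pole of `M`. -/
noncomputable def evalAt (M : Matrix (Fin m) (Fin n) (Mer Ω)) (w : ℂ) :
    Matrix (Fin m) (Fin n) ℂ :=
  M.map fun f => f.value w

/-- The normal rank: the rank over the field `𝕄(Ω)`. -/
noncomputable def nrank (M : Matrix (Fin m) (Fin n) (Mer Ω)) : ℕ := M.rank

/-- A square holomorphic matrix is regular if its normal rank is its size. -/
def IsRegularMatrix (D : Matrix (Fin n) (Fin n) (Hol Ω)) : Prop := nrank (toMer D) = n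

/-- The relation `A ∼_Ω B`: `A = E B F` with `E`, `F` invertible over `ℍ(Ω)`. -/
def Equivalent (A B : Matrix (Fin m) (Fin n) (Mer Ω)) : Prop :=
  ∃ (E : GL (Fin m) (Hol Ω)) (F : GL (Fin n) (Hol Ω)),
    A = toMer (E : Matrix (Fin m) (Fin m) (Hol Ω)) * B * toMer (F : Matrix (Fin n) (Fin n) (Hol Ω))

/-- The `m × n` matrix `diag(d_1, …, d_r) ⊕ 0_{m-r, n-r}`. -/
noncomputable def rectDiag (m n : ℕ) (d : Fin r → Mer Ω) : Matrix (Fin m) (Fin n) (Mer Ω) :=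
  Matrix.of fun i j => if h : (i : ℕ) = j ∧ (i : ℕ) < r then d ⟨i, h.2⟩ else 0

/-- `diag(φ_1, …, φ_r) ⊕ 0` is the Smith form of the holomorphic matrix `A` on `Ω`. -/
structure IsSmithForm (A : Matrix (Fin m) (Fin n) (Hol Ω)) (φ : Fin r → Hol Ω) : Prop where
  nrank_eq : nrank (toMer A) = r
  ne_zero : ∀ j, φ j ≠ 0
  dvd : ∀ i j, i ≤ j → φ i ∣ φ j
  equivalent : Equivalent (toMer A) (rectDiag m n fun j => (φ j : Mer Ω))

/-- `diag(φ_1/ψ_1, …, φ_r/ψ_r) ⊕ 0` is the Smith–McMillan form of the meromorphic matrix `M` on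
`Ω`, with invariant zero functions `φ_j` and invariant pole functions `ψ_j`. -/
structure IsSmithMcMillanForm (M : Matrix (Fin m) (Fin n) (Mer Ω)) (φ ψ : Fin r → Hol Ω) :
    Prop where
  nrank_eq : nrank M = r
  zero_ne_zero : ∀ j, φ j ≠ 0
  pole_ne_zero : ∀ j, ψ j ≠ 0
  zero_dvd : ∀ i j, i ≤ j → φ i ∣ φ j
  pole_dvd : ∀ i j, i ≤ j → ψ j ∣ ψ i
  relPrime : ∀ j, IsRelPrime (φ j) (ψ j)
  equivalent : Equivalent M (rectDiag m n fun j => (φ j : Mer Ω) / (ψ j : Mer Ω))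

/-- The spectrum `σ_Ω(A)` (set of eigenvalues) of a holomorphic matrix. -/
def eigenvalues (A : Matrix (Fin m) (Fin n) (Hol Ω)) : Set ℂ :=
  {w | w ∈ Ω.carrier ∧ (evalAt (toMer A) w).rank < nrank (toMer A)}

/-- The set `℘_Ω(M)` of poles of a meromorphic matrix. -/
def poles (M : Matrix (Fin m) (Fin n) (Mer Ω)) : Set ℂ :=
  {w | w ∈ Ω.carrier ∧ ∃ i j, (M i j).IsPole w}

/-- The eigenspectrum of a meromorphic matrix: the points that are not poles and where the rank
drops below the normal rank. -/
def eigenspectrum (M : Matrix (Fin m) (Fin n) (Mer Ω)) : Set ℂ :=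
  {w | w ∈ Ω.carrier ∧ w ∉ poles M ∧ (evalAt M w).rank < nrank M}

/-- The eigenpoles of a meromorphic matrix: the poles `w` for which there is a holomorphic vector
`f` with `M(z) f(z) → 0` as `z → w` whose value `f(w)` is not the value at `w` of a holomorphic
vector of the null space of `M`. The last condition contains `f(w) ≠ 0` (take `v = 0`) and
`M f ≠ 0` (take `v = f`). -/
def eigenpoles (M : Matrix (Fin m) (Fin n) (Mer Ω)) : Set ℂ :=
  {w | w ∈ poles M ∧ ∃ f : Fin n → Hol Ω,
    (∀ v : Fin n → Hol Ω, M.mulVec (fun j => (v j : Mer Ω)) = 0 →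
      (fun j => (f j : Mer Ω).value w) ≠ fun j => (v j : Mer Ω).value w) ∧
    ∀ i, (M.mulVec (fun j => (f j : Mer Ω)) i).TendstoZero w}

/-- The zeros `σ_Ω(M)` of a meromorphic matrix. -/
def zeros (M : Matrix (Fin m) (Fin n) (Mer Ω)) : Set ℂ := eigenspectrum M ∪ eigenpoles M

open Classical in
/-- The zero index `Ind_e(w, A) = (ν_1(w), …, ν_r(w))` of a holomorphic matrix, where `ν_j` is the
principal divisor of the `j`-th invariant function of `A`. -/
noncomputable def smithZeroIndex (A : Matrix (Fin m) (Fin n) (Hol Ω)) (w : ℂ) : List ℤ :=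
  if h : ∃ φ : Fin (nrank (toMer A)) → Hol Ω, IsSmithForm A φ then
    List.ofFn fun j => (h.choose j : Mer Ω).divisor w
  else []

open Classical in
/-- The zero index `Ind_e(w, M) = (ν_1(w), …, ν_r(w))` of a meromorphic matrix, where `ν_j` is the
principal divisor of the `j`-th invariant zero function of `M`. -/
noncomputable def zeroIndex (M : Matrix (Fin m) (Fin n) (Mer Ω)) (w : ℂ) : List ℤ :=
  if h : ∃ p : (Fin (nrank M) → Hol Ω) × (Fin (nrank M) → Hol Ω),
      IsSmithMcMillanForm M p.1 p.2 then
    List.ofFn fun j => (h.choose.1 j : Mer Ω).divisor w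
  else []

open Classical in
/-- The pole index `Ind_p(w, M) = (κ_1(w), …, κ_r(w))` of a meromorphic matrix, where `κ_j` is the
principal divisor of the `j`-th invariant pole function of `M`. -/
noncomputable def poleIndex (M : Matrix (Fin m) (Fin n) (Mer Ω)) (w : ℂ) : List ℤ :=
  if h : ∃ p : (Fin (nrank M) → Hol Ω) × (Fin (nrank M) → Hol Ω),
      IsSmithMcMillanForm M p.1 p.2 then
    List.ofFn fun j => (h.choose.2 j : Mer Ω).divisor w
  else []

/-- `M = N D⁻¹` is a right coprime matrix-fraction description: `D` is regular and the stacked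
matrix `[N(z); D(z)]` has rank `n` at every point `z` of `Ω`. -/
structure IsRightCoprimeMFD (M : Matrix (Fin m) (Fin n) (Mer Ω))
    (N : Matrix (Fin m) (Fin n) (Hol Ω)) (D : Matrix (Fin n) (Fin n) (Hol Ω)) : Prop where
  regular : IsRegularMatrix D
  eq_mul_inv : M = toMer N * (toMer D)⁻¹
  coprime : ∀ z ∈ Ω.carrier,
    (Matrix.fromRows (evalAt (toMer N) z) (evalAt (toMer D) z)).rank = n

/-- The sequence `(1, …, 1, ψ_r, ψ_{r-1}, …, ψ_1)` of length `n`. -/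
noncomputable def onesThenReverse (n : ℕ) (ψ : Fin r → Hol Ω) : Fin n → Hol Ω :=
  fun i => if h : n - 1 - (i : ℕ) < r then ψ ⟨n - 1 - i, h⟩ else 1

end Matrices

end MeroMat

open MeroMat

/-! Write `M = E Δ F` with `E`, `F` unimodular and `Δ = diag(φ_j/ψ_j) ⊕ 0`. Put `N₀ = E (diag(φ) ⊕
0)` and `D₀ = F⁻¹ diag(ψ_1, …, ψ_r, 1, …, 1)`. Then `M D₀ = N₀`, and the stacked matrix of `N₀` and
`D₀` has a trivial kernel at every point, because relatively prime `φ_j`, `ψ_j` have no common zero.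
So this is a right coprime factorization with its Smith forms in plain sight, up to reversing the
diagonal of `D₀`.

Any other right coprime factorization is `N = N₀ U`, `D = D₀ U` with `U` unimodular
(`IsRightCoprimeMFD.exists_unimodular`). Indeed `U = D₀⁻¹ D` is meromorphic and carries the stack of
`N₀`, `D₀` to that of `N`, `D`; the first stack has a left inverse near each point, so `U` has no
poles, and by symmetry neither has `U⁻¹`. This argument is local: it needs no Bézout identity over
`ℍ(Ω)`, only that a meromorphic function without poles is holomorphic.

For the indices, the local orders of the invariant functions must not depend on the chosen Smith
form; `IsSmithForm.order_le` shows this with a zero block in a matrix that would have to be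
invertible. The poles and zeros of `M` are read off from `Δ`, since unimodular factors change
neither; at a pole the eigenpole condition is tested on the coordinates of `F f`. -/

namespace MeroMat

/-! ### Orders, regularity and values at a point -/

namespace Mer

variable {Ω : Region} {w : ℂ}

/-- The order of a meromorphic function at a point. -/
noncomputable def order (f : Mer Ω) (w : ℂ) : WithTop ℤ := meromorphicOrderAt f.rep w

theorem order_mk {f : ℂ → ℂ} (hf : MeromorphicOn f Ω.carrier) (hw : w ∈ Ω.carrier) :
    (mk f hf : Mer Ω).order w = meromorphicOrderAt f w :=
  meromorphicOrderAt_congr (rep_mk f hf hw)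

theorem rep_add (f g : Mer Ω) (hw : w ∈ Ω.carrier) : (f + g).rep =ᶠ[𝓝[≠] w] f.rep + g.rep := by
  have h : f + g = mk (f.rep + g.rep)
      (fun z hz => (f.rep_meromorphicOn z hz).add (g.rep_meromorphicOn z hz)) := by
    conv_lhs => rw [← mk_rep f, ← mk_rep g]
    rfl
  rw [h]
  exact rep_mk _ _ hw

theorem rep_mul (f g : Mer Ω) (hw : w ∈ Ω.carrier) : (f * g).rep =ᶠ[𝓝[≠] w] f.rep * g.rep := by
  have h : f * g = mk (f.rep * g.rep)
      (fun z hz => (f.rep_meromorphicOn z hz).mul (g.rep_meromorphicOn z hz)) := by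
    conv_lhs => rw [← mk_rep f, ← mk_rep g]
    rfl
  rw [h]
  exact rep_mk _ _ hw

theorem rep_neg (f : Mer Ω) (hw : w ∈ Ω.carrier) : (-f).rep =ᶠ[𝓝[≠] w] -f.rep := by
  have h : -f = mk (-f.rep) (fun z hz => (f.rep_meromorphicOn z hz).neg) := by
    conv_lhs => rw [← mk_rep f]
    rfl
  rw [h]
  exact rep_mk _ _ hw

theorem rep_zero (hw : w ∈ Ω.carrier) : (0 : Mer Ω).rep =ᶠ[𝓝[≠] w] 0 :=
  rep_mk 0 (fun z _ => MeromorphicAt.const 0 z) hw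

theorem rep_one (hw : w ∈ Ω.carrier) : (1 : Mer Ω).rep =ᶠ[𝓝[≠] w] 1 :=
  rep_mk 1 (fun z _ => MeromorphicAt.const 1 z) hw

theorem order_mul (f g : Mer Ω) (hw : w ∈ Ω.carrier) :
    (f * g).order w = f.order w + g.order w := by
  rw [order, meromorphicOrderAt_congr (rep_mul f g hw)]
  exact meromorphicOrderAt_mul (f.rep_meromorphicOn w hw) (g.rep_meromorphicOn w hw)

/-- Identity theorem: as `Ω` is connected, infinite order at one point propagates to every point. -/
theorem order_eq_top_iff {f : Mer Ω} (hw : w ∈ Ω.carrier) : f.order w = ⊤ ↔ f = 0 := by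
  constructor
  · intro h
    rw [← mk_rep f]
    refine mk_eq_mk_iff (hg := fun z _ => MeromorphicAt.const 0 z).2 fun z hz => ?_
    refine meromorphicOrderAt_eq_top_iff.1 ?_
    by_contra hzt
    exact f.rep_meromorphicOn.meromorphicOrderAt_ne_top_of_isPreconnected
      Ω.isConnected.isPreconnected hz hw hzt h
  · rintro rfl
    exact meromorphicOrderAt_eq_top_iff.2 (rep_zero hw)

theorem order_one (hw : w ∈ Ω.carrier) : (1 : Mer Ω).order w = 0 := by
  -- The order of `1` is finite and equals twice itself.
  have h := order_mul (1 : Mer Ω) 1 hw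
  have h1 : (1 : Mer Ω).order w ≠ ⊤ := fun h => one_ne_zero ((order_eq_top_iff hw).1 h)
  rw [mul_one] at h
  lift (1 : Mer Ω).order w to ℤ using h1 with a
  norm_cast at h ⊢
  omega

/-- The ring of meromorphic functions on `Ω` without a pole at `w`. -/
noncomputable def regularAt (hw : w ∈ Ω.carrier) : Subring (Mer Ω) where
  carrier := {f | 0 ≤ f.order w}
  mul_mem' := fun {f g} hf hg => by
    simp only [Set.mem_ofPred_eq] at hf hg ⊢
    rw [order_mul f g hw]
    exact add_nonneg hf hg
  one_mem' := (order_one hw).ge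
  add_mem' := fun {f g} hf hg => by
    simp only [Set.mem_ofPred_eq] at hf hg ⊢
    rw [order, meromorphicOrderAt_congr (rep_add f g hw)]
    exact (le_min hf hg).trans
      (meromorphicOrderAt_add (f.rep_meromorphicOn w hw) (g.rep_meromorphicOn w hw))
  zero_mem' := by simp [(order_eq_top_iff hw).2 rfl]
  neg_mem' := fun {f} hf => by
    simp only [Set.mem_ofPred_eq] at hf ⊢
    rw [order, meromorphicOrderAt_congr (rep_neg f hw), ← meromorphicOrderAt_neg]
    exact hf

theorem mem_regularAt {f : Mer Ω} (hw : w ∈ Ω.carrier) : f ∈ regularAt hw ↔ 0 ≤ f.order w :=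
  Iff.rfl

theorem isPole_iff {f : Mer Ω} (hw : w ∈ Ω.carrier) : f.IsPole w ↔ f ∉ regularAt hw := by
  rw [mem_regularAt, not_le]
  rfl

theorem tendsto_value {f : Mer Ω} (hw : w ∈ Ω.carrier) (hf : f ∈ regularAt hw) :
    Tendsto f.rep (𝓝[≠] w) (𝓝 (f.value w)) :=
  tendsto_nhds_limUnder
    ((tendsto_nhds_iff_meromorphicOrderAt_nonneg (f.rep_meromorphicOn w hw)).2 hf)

theorem value_eq {f : Mer Ω} {c : ℂ} (h : Tendsto f.rep (𝓝[≠] w) (𝓝 c)) : f.value w = c :=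
  h.limUnder_eq

theorem value_zero (hw : w ∈ Ω.carrier) : (0 : Mer Ω).value w = 0 :=
  value_eq (tendsto_const_nhds.congr' (rep_zero hw).symm)

/-- Evaluation at `w` of the functions without a pole at `w`. -/
noncomputable def evalRegular (hw : w ∈ Ω.carrier) : regularAt hw →+* ℂ where
  toFun f := (f : Mer Ω).value w
  map_one' := value_eq (tendsto_const_nhds.congr' (rep_one hw).symm)
  map_zero' := value_zero hw
  map_mul' f g := value_eq
    (((tendsto_value hw f.2).mul (tendsto_value hw g.2)).congr' (rep_mul _ _ hw).symm)
  map_add' f g := value_eq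
    (((tendsto_value hw f.2).add (tendsto_value hw g.2)).congr' (rep_add _ _ hw).symm)

theorem tendstoZero_iff {f : Mer Ω} (hw : w ∈ Ω.carrier) : f.TendstoZero w ↔ 0 < f.order w :=
  tendsto_zero_iff_meromorphicOrderAt_pos (f.rep_meromorphicOn w hw)

theorem value_eq_zero_iff {f : Mer Ω} (hw : w ∈ Ω.carrier) (hf : f ∈ regularAt hw) :
    f.value w = 0 ↔ 0 < f.order w := by
  rw [← tendstoZero_iff hw]
  refine ⟨fun h => ?_, value_eq⟩
  have := tendsto_value hw hf
  rwa [h] at this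

theorem order_eq_zero {f : Mer Ω} (hw : w ∈ Ω.carrier) (hf : f ∈ regularAt hw)
    (h : f.value w ≠ 0) : f.order w = 0 := by
  refine le_antisymm ?_ hf
  rwa [ne_eq, value_eq_zero_iff hw hf, not_lt] at h

theorem inv_mem_regularAt {f : Mer Ω} (hw : w ∈ Ω.carrier) (hf : f ∈ regularAt hw)
    (h : f.value w ≠ 0) : f⁻¹ ∈ regularAt hw := by
  have hf0 : f ≠ 0 := by
    rintro rfl
    exact h (map_zero (evalRegular hw))
  have h1 := order_mul f f⁻¹ hw
  rw [mul_inv_cancel₀ hf0, order_one hw, order_eq_zero hw hf h, zero_add] at h1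
  exact h1.le

/-- This makes a matrix over the local ring at `w` invertible as soon as its determinant is nonzero
at `w`. -/
theorem isUnit_of_evalRegular_ne_zero {hw : w ∈ Ω.carrier} {f : regularAt hw}
    (h : evalRegular hw f ≠ 0) : IsUnit f := by
  have hf0 : (f : Mer Ω) ≠ 0 := by
    intro h0
    exact h (by rw [show f = 0 from Subtype.ext h0, map_zero])
  exact IsUnit.of_mul_eq_one ⟨(f : Mer Ω)⁻¹, inv_mem_regularAt hw f.2 h⟩
    (Subtype.ext (mul_inv_cancel₀ hf0))

end Mer

/-! ### Holomorphic functions as everywhere regular meromorphic functions -/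

open Mer

variable {Ω : Region} {w : ℂ}

theorem holSubring_le_regularAt (hw : w ∈ Ω.carrier) : holSubring Ω ≤ regularAt hw := by
  rintro _ ⟨f, hf, rfl⟩
  rw [mem_regularAt, order_mk _ hw]
  exact (hf w hw).meromorphicOrderAt_nonneg

/-- The normal form of a representative has its removable singularities filled in, so it is analytic
wherever the order is nonnegative. This is the passage from local to global. -/
theorem mem_holSubring_of_forall {f : Mer Ω} (h : ∀ w, ∀ hw : w ∈ Ω.carrier, f ∈ regularAt hw) :
    f ∈ holSubring Ω := by
  have hf := f.rep_meromorphicOn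
  have han : AnalyticOnNhd ℂ (toMeromorphicNFOn f.rep Ω.carrier) Ω.carrier := fun z hz => by
    have h1 := meromorphicNFOn_toMeromorphicNFOn f.rep Ω.carrier hz
    rw [← h1.meromorphicOrderAt_nonneg_iff_analyticAt, meromorphicOrderAt_toMeromorphicNFOn hf hz]
    exact h z hz
  refine ⟨_, han, ?_⟩
  conv_rhs => rw [← mk_rep f]
  exact mk_eq_mk_iff.2 fun z hz => hf.toMeromorphicNFOn_eq_self_on_nhdsNE hz

namespace Hol

/-- Holomorphic functions on `Ω` have no pole at `w`. -/
noncomputable def toRegular (hw : w ∈ Ω.carrier) : Hol Ω →+* regularAt hw :=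
  Subring.inclusion (holSubring_le_regularAt hw)

/-- Evaluation of holomorphic functions at `w`. -/
noncomputable def eval (hw : w ∈ Ω.carrier) : Hol Ω →+* ℂ :=
  (evalRegular hw).comp (toRegular hw)

theorem eval_apply (hw : w ∈ Ω.carrier) (f : Hol Ω) : eval hw f = (f : Mer Ω).value w := rfl

theorem mem_regularAt (hw : w ∈ Ω.carrier) (f : Hol Ω) : (f : Mer Ω) ∈ regularAt hw :=
  holSubring_le_regularAt hw f.2

theorem eval_eq_zero_iff (hw : w ∈ Ω.carrier) (f : Hol Ω) :
    eval hw f = 0 ↔ 0 < (f : Mer Ω).order w :=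
  value_eq_zero_iff hw (mem_regularAt hw f)

/-- A holomorphic function on the whole plane, restricted to `Ω`. -/
noncomputable def ofEntire (f : ℂ → ℂ) (hf : ∀ z, AnalyticAt ℂ f z) : Hol Ω :=
  ⟨mk f fun z _ => (hf z).meromorphicAt, f, fun z _ => hf z, rfl⟩

theorem eval_ofEntire (hw : w ∈ Ω.carrier) (f : ℂ → ℂ) (hf : ∀ z, AnalyticAt ℂ f z) :
    eval hw (ofEntire f hf) = f w :=
  value_mk f (fun z _ => (hf z).meromorphicAt) hw (hf w).continuousAt

theorem eval_surjective (hw : w ∈ Ω.carrier) : Function.Surjective (eval hw) := fun c =>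
  ⟨ofEntire (fun _ => c) fun _ => analyticAt_const, eval_ofEntire hw _ _⟩

/-- The function `z ↦ z - w`. -/
noncomputable def subPoint (w : ℂ) : Hol Ω :=
  ofEntire (fun z => z - w) fun _ => analyticAt_id.sub analyticAt_const

theorem order_subPoint_self (hw : w ∈ Ω.carrier) : ((subPoint w : Hol Ω) : Mer Ω).order w = 1 := by
  refine (order_mk (f := fun z => z - w)
    (fun z _ => (analyticAt_id.sub analyticAt_const).meromorphicAt) hw).trans ?_
  refine (meromorphicOrderAt_eq_int_iff (n := 1) ?_).2 ⟨1, analyticAt_const, one_ne_zero, ?_⟩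
  · exact (analyticAt_id.sub analyticAt_const).meromorphicAt
  · simp

theorem eval_subPoint (hw : w ∈ Ω.carrier) (v : ℂ) : eval hw (subPoint v) = w - v :=
  eval_ofEntire hw _ _

/-- The quotient has no pole: at `w` the order of `f` is at least one, and elsewhere `z - w` is
locally invertible. -/
theorem subPoint_dvd (hw : w ∈ Ω.carrier) {f : Hol Ω} (hf : eval hw f = 0) : subPoint w ∣ f := by
  have hs : ((subPoint w : Hol Ω) : Mer Ω) ≠ 0 := by
    intro h
    have := order_subPoint_self hw
    rw [h, (order_eq_top_iff hw).2 rfl] at this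
    exact absurd this (by decide)
  have hmem : (f : Mer Ω) / ((subPoint w : Hol Ω) : Mer Ω) ∈ holSubring Ω := by
    refine mem_holSubring_of_forall fun v hv => ?_
    by_cases hvw : v = w
    · subst hvw
      rw [eval_eq_zero_iff] at hf
      have h1 := order_mul ((f : Mer Ω) / ((subPoint v : Hol Ω) : Mer Ω)) (subPoint v : Hol Ω) hv
      rw [div_mul_cancel₀ _ hs, order_subPoint_self hv] at h1
      rw [Mer.mem_regularAt]
      rw [h1] at hf
      generalize ((f : Mer Ω) / ((subPoint v : Hol Ω) : Mer Ω)).order v = a at hf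
      cases a with
      | top => exact le_top
      | coe a =>
        norm_cast at hf ⊢
        omega
    · rw [div_eq_mul_inv]
      refine mul_mem (mem_regularAt hv f) (inv_mem_regularAt hv (mem_regularAt hv _) ?_)
      rw [← eval_apply hv, eval_subPoint]
      exact sub_ne_zero.2 hvw
  exact ⟨⟨_, hmem⟩, Subtype.ext (mul_div_cancel₀ _ hs).symm⟩

theorem eval_ne_zero_of_isUnit (hw : w ∈ Ω.carrier) {f : Hol Ω} (hf : IsUnit f) :
    eval hw f ≠ 0 := (hf.map (eval hw)).ne_zero

/-- A common zero `w` would give the common divisor `z - w`, which vanishes at `w` and so is not a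
unit. -/
theorem eval_ne_zero_of_isRelPrime (hw : w ∈ Ω.carrier) {f g : Hol Ω} (h : IsRelPrime f g)
    (hf : eval hw f = 0) : eval hw g ≠ 0 := fun hg =>
  eval_ne_zero_of_isUnit hw (h (subPoint_dvd hw hf) (subPoint_dvd hw hg)) (by simp [eval_subPoint])

theorem order_le_of_dvd (hw : w ∈ Ω.carrier) {f g : Hol Ω} (h : f ∣ g) :
    (f : Mer Ω).order w ≤ (g : Mer Ω).order w := by
  obtain ⟨k, rfl⟩ := h
  rw [show ((f * k : Hol Ω) : Mer Ω) = f * k from rfl, order_mul _ _ hw]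
  exact le_add_of_nonneg_right (mem_regularAt hw k)

end Hol

end MeroMat

namespace MeroMat

open Mer

/-! ### Rectangular diagonal matrices, rank and determinants -/

section RectDiagonal

variable {R S K : Type*} {m n r : ℕ}

/-- The `m × n` matrix with diagonal entries `d_1, …, d_r` and all other entries zero. -/
def rectDiagonal [Zero R] (m n : ℕ) (d : Fin r → R) : Matrix (Fin m) (Fin n) R :=
  Matrix.of fun i j => if h : (i : ℕ) = j ∧ (i : ℕ) < r then d ⟨i, h.2⟩ else 0

theorem rectDiag_eq_rectDiagonal {Ω : Region} (d : Fin r → Mer Ω) :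
    rectDiag m n d = rectDiagonal m n d := rfl

theorem rectDiagonal_map [Zero R] [Zero S] (d : Fin r → R) (f : R → S) (hf : f 0 = 0) :
    (rectDiagonal m n d).map f = rectDiagonal m n fun j => f (d j) := by
  ext i j
  simp only [rectDiagonal, Matrix.map_apply, Matrix.of_apply]
  split_ifs <;> simp [hf]

theorem rectDiagonal_self [Zero R] (d : Fin n → R) :
    rectDiagonal n n d = Matrix.diagonal d := by
  ext i j
  simp [rectDiagonal, Matrix.diagonal_apply, Fin.ext_iff]

theorem rectDiagonal_mulVec [NonUnitalNonAssocSemiring R] (hn : r ≤ n) (d : Fin r → R)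
    (x : Fin n → R) (i : Fin m) :
    (rectDiagonal m n d).mulVec x i =
      if h : (i : ℕ) < r then d ⟨i, h⟩ * x ⟨i, h.trans_le hn⟩ else 0 := by
  simp only [Matrix.mulVec, dotProduct, rectDiagonal, Matrix.of_apply]
  split_ifs with h
  · rw [Finset.sum_eq_single ⟨i, h.trans_le hn⟩]
    · simp [h]
    · intro b _ hb
      rw [dif_neg, zero_mul]
      exact fun h' => hb (Fin.ext h'.1.symm)
    · simp
  · exact Finset.sum_eq_zero fun j _ => by rw [dif_neg (fun h' => h h'.2), zero_mul]

theorem rectDiagonal_mul_apply [NonUnitalNonAssocSemiring R] {l : ℕ} (hn : r ≤ n) (d : Fin r → R)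
    (B : Matrix (Fin n) (Fin l) R) (i : Fin m) (j : Fin l) :
    (rectDiagonal m n d * B) i j =
      if h : (i : ℕ) < r then d ⟨i, h⟩ * B ⟨i, h.trans_le hn⟩ j else 0 :=
  rectDiagonal_mulVec hn d (fun k => B k j) i

theorem mul_rectDiagonal_apply [NonUnitalNonAssocSemiring R] {l : ℕ} (hm : r ≤ m) (d : Fin r → R)
    (B : Matrix (Fin l) (Fin m) R) (i : Fin l) (j : Fin n) :
    (B * rectDiagonal m n d) i j =
      if h : (j : ℕ) < r then B i ⟨j, h.trans_le hm⟩ * d ⟨j, h⟩ else 0 := by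
  simp only [Matrix.mul_apply, rectDiagonal, Matrix.of_apply]
  split_ifs with h
  · rw [Finset.sum_eq_single ⟨j, h.trans_le hm⟩]
    · simp [h]
    · intro b _ hb
      rw [dif_neg, mul_zero]
      exact fun h' => hb (Fin.ext h'.1)
    · simp
  · exact Finset.sum_eq_zero fun k _ => by
      rw [dif_neg fun h' : (k : ℕ) = j ∧ (k : ℕ) < r => h (h'.1 ▸ h'.2), mul_zero]

theorem rectDiagonal_mul_diagonal [NonUnitalNonAssocSemiring R] (hn : r ≤ n) (d : Fin r → R)
    (e : Fin n → R) :
    rectDiagonal m n d * Matrix.diagonal e =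
      rectDiagonal m n fun j => d j * e (Fin.castLE hn j) := by
  ext i j
  rw [Matrix.mul_diagonal]
  simp only [rectDiagonal, Matrix.of_apply]
  split_ifs with h
  · congr 2
    exact Fin.ext h.1.symm
  · simp

/-- Each of the two matrices is obtained from the other by multiplying with truncated identities, so
each rank bounds the other. -/
theorem rank_rectDiagonal [Field K] (hm : r ≤ m) (hn : r ≤ n) (d : Fin r → K) :
    (rectDiagonal m n d).rank = (Matrix.diagonal d).rank := by
  refine le_antisymm ?_ ?_
  · have h : rectDiagonal m n d = rectDiagonal m r (fun _ : Fin r => (1 : K)) * Matrix.diagonal d *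
        rectDiagonal r n (fun _ : Fin r => (1 : K)) := by
      ext i j
      rw [mul_rectDiagonal_apply le_rfl]
      simp only [Matrix.mul_diagonal, rectDiagonal, Matrix.of_apply]
      split_ifs with h1 h2 h3 <;> first | omega | simp_all
    rw [h]
    exact (Matrix.rank_mul_le_left _ _).trans (Matrix.rank_mul_le_right _ _)
  · have h : Matrix.diagonal d = rectDiagonal r m (fun _ : Fin r => (1 : K)) * rectDiagonal m n d *
        rectDiagonal n r (fun _ : Fin r => (1 : K)) := by
      ext i j
      rw [mul_rectDiagonal_apply hn, dif_pos j.2, rectDiagonal_mul_apply hm, dif_pos i.2]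
      simp [rectDiagonal, Matrix.diagonal_apply, Fin.ext_iff]
    rw [h]
    exact (Matrix.rank_mul_le_left _ _).trans (Matrix.rank_mul_le_right _ _)

theorem rank_rectDiagonal_of_ne_zero [Field K] (hm : r ≤ m) (hn : r ≤ n) {d : Fin r → K}
    (hd : ∀ j, d j ≠ 0) : (rectDiagonal m n d).rank = r := by
  classical
  rw [rank_rectDiagonal hm hn, Matrix.rank_diagonal]
  simp [hd]

theorem rank_rectDiagonal_lt_iff [Field K] (hm : r ≤ m) (hn : r ≤ n) {d : Fin r → K} :
    (rectDiagonal m n d).rank < r ↔ ∃ j, d j = 0 := by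
  classical
  constructor
  · intro h
    by_contra! hd
    exact h.ne (rank_rectDiagonal_of_ne_zero hm hn hd)
  · rintro ⟨j, hj⟩
    rw [rank_rectDiagonal hm hn, Matrix.rank_diagonal]
    exact (Fintype.card_subtype_lt (x := j) (by simpa using hj)).trans_eq (Fintype.card_fin r)

theorem rank_mul_mul_of_isUnit [Field K] {E : Matrix (Fin m) (Fin m) K}
    {F : Matrix (Fin n) (Fin n) K} (hE : IsUnit E) (hF : IsUnit F) (A : Matrix (Fin m) (Fin n) K) :
    (E * A * F).rank = A.rank := by
  rw [Matrix.rank_mul_eq_left_of_isUnit_det _ _ ((Matrix.isUnit_iff_isUnit_det _).1 hF),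
    Matrix.rank_mul_eq_right_of_isUnit_det _ _ ((Matrix.isUnit_iff_isUnit_det _).1 hE)]

/-- A square matrix with a zero block in the rows `≥ k` and columns `≤ k` is singular. -/
theorem det_eq_zero_of_zero_block [CommRing R] {A : Matrix (Fin n) (Fin n) R} (k : Fin n)
    (hA : ∀ i j, k ≤ i → j ≤ k → A i j = 0) : A.det = 0 := by
  rw [Matrix.det_apply']
  refine Finset.sum_eq_zero fun σ _ => ?_
  -- Pigeonhole: otherwise `σ` would inject the indices `≤ k` into those `< k`. So every term of the
  -- Leibniz expansion has a factor from the zero block.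
  obtain ⟨j, hj, hkj⟩ : ∃ j, j ≤ k ∧ k ≤ σ j := by
    by_contra! h
    have := Finset.card_le_card_of_injOn (s := Finset.Iic k) (t := Finset.Iio k) σ
      (fun j hj => by simpa using h j (by simpa using hj)) σ.injective.injOn
    rw [Fin.card_Iic, Fin.card_Iio] at this
    omega
  exact mul_eq_zero_of_right _ (Finset.prod_eq_zero (Finset.mem_univ j) (hA _ _ hkj hj))

theorem exists_leftInverse_of_mulVec_injective [Field K] {ι κ : Type*} [Fintype ι] [Fintype κ]
    [DecidableEq ι] [DecidableEq κ] {A : Matrix ι κ K} (hA : Function.Injective A.mulVec) :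
    ∃ L : Matrix κ ι K, L * A = 1 := by
  obtain ⟨g, hg⟩ := LinearMap.exists_leftInverse_of_injective A.mulVecLin
    (LinearMap.ker_eq_bot.2 hA)
  refine ⟨LinearMap.toMatrix' g, ?_⟩
  apply_fun LinearMap.toMatrix' at hg
  rwa [LinearMap.toMatrix'_comp, LinearMap.toMatrix'_id, ← Matrix.toLin'_apply',
    LinearMap.toMatrix'_toLin'] at hg

theorem mulVec_injective_of_rank_eq [Field K] {ι : Type*} [Fintype ι] {A : Matrix ι (Fin n) K}
    (hA : A.rank = n) : Function.Injective A.mulVec := by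
  have h := A.mulVecLin.finrank_range_add_finrank_ker
  rw [← Matrix.rank, hA, Module.finrank_fin_fun, Nat.add_eq_left, Submodule.finrank_eq_zero] at h
  exact LinearMap.ker_eq_bot.1 h

end RectDiagonal

/-! ### Holomorphic matrices and their values at a point -/

section Evaluation

variable {Ω : Region} {m n l r : ℕ} {w : ℂ}

theorem toMer_injective : Function.Injective (toMer (Ω := Ω) (m := m) (n := n)) :=
  Matrix.map_injective Subtype.val_injective

theorem toMer_mul (A : Matrix (Fin m) (Fin n) (Hol Ω)) (B : Matrix (Fin n) (Fin l) (Hol Ω)) :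
    toMer (A * B) = toMer A * toMer B :=
  Matrix.map_mul (f := (holSubring Ω).subtype)

theorem toMer_one : toMer (1 : Matrix (Fin n) (Fin n) (Hol Ω)) = 1 :=
  Matrix.map_one (holSubring Ω).subtype (map_zero _) (map_one _)

theorem toMer_mulVec (A : Matrix (Fin m) (Fin n) (Hol Ω)) (x : Fin n → Hol Ω) :
    (toMer A).mulVec (fun j => (x j : Mer Ω)) = fun i => (A.mulVec x i : Mer Ω) :=
  funext fun i => ((holSubring Ω).subtype.map_mulVec A x i).symm

theorem toMer_rectDiagonal (φ : Fin r → Hol Ω) :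
    toMer (rectDiagonal m n φ) = rectDiag m n fun j => (φ j : Mer Ω) :=
  rectDiagonal_map _ _ rfl

theorem toMer_inv_mul (E : GL (Fin n) (Hol Ω)) :
    toMer ((E⁻¹ : GL (Fin n) (Hol Ω)) : Matrix (Fin n) (Fin n) (Hol Ω)) *
      toMer (E : Matrix (Fin n) (Fin n) (Hol Ω)) = 1 := by
  rw [← toMer_mul, E.inv_mul, toMer_one]

theorem toMer_mul_inv (E : GL (Fin n) (Hol Ω)) :
    toMer (E : Matrix (Fin n) (Fin n) (Hol Ω)) *
      toMer ((E⁻¹ : GL (Fin n) (Hol Ω)) : Matrix (Fin n) (Fin n) (Hol Ω)) = 1 := by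
  rw [← toMer_mul, E.mul_inv, toMer_one]

theorem isUnit_toMer (E : GL (Fin n) (Hol Ω)) :
    IsUnit (toMer (E : Matrix (Fin n) (Fin n) (Hol Ω))) :=
  IsUnit.of_mul_eq_one _ (toMer_mul_inv E)

theorem evalAt_toMer (hw : w ∈ Ω.carrier) (A : Matrix (Fin m) (Fin n) (Hol Ω)) :
    evalAt (toMer A) w = A.map (Hol.eval hw) := rfl

theorem isUnit_map_eval (hw : w ∈ Ω.carrier) (E : GL (Fin n) (Hol Ω)) :
    IsUnit ((E : Matrix (Fin n) (Fin n) (Hol Ω)).map (Hol.eval hw)) :=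
  E.isUnit.map (Hol.eval hw).mapMatrix

theorem evalAt_rectDiag (hw : w ∈ Ω.carrier) (d : Fin r → Mer Ω) :
    evalAt (rectDiag m n d) w = rectDiagonal m n fun j => (d j).value w := by
  ext i j
  rw [evalAt, Matrix.map_apply, rectDiag, rectDiagonal, Matrix.of_apply, Matrix.of_apply]
  split_ifs
  · rfl
  · exact value_zero hw

theorem evalAt_mul (hw : w ∈ Ω.carrier) {A : Matrix (Fin m) (Fin n) (Mer Ω)}
    {B : Matrix (Fin n) (Fin l) (Mer Ω)} (hA : ∀ i j, A i j ∈ regularAt hw)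
    (hB : ∀ i j, B i j ∈ regularAt hw) : evalAt (A * B) w = evalAt A w * evalAt B w := by
  let A' : Matrix (Fin m) (Fin n) (regularAt hw) := Matrix.of fun i j => ⟨A i j, hA i j⟩
  let B' : Matrix (Fin n) (Fin l) (regularAt hw) := Matrix.of fun i j => ⟨B i j, hB i j⟩
  have h : A * B = (A' * B').map (regularAt hw).subtype := by
    rw [Matrix.map_mul]
    rfl
  rw [h]
  exact Matrix.map_mul (f := evalRegular hw)

theorem mul_mem_regularAt (hw : w ∈ Ω.carrier) {A : Matrix (Fin m) (Fin n) (Mer Ω)}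
    {B : Matrix (Fin n) (Fin l) (Mer Ω)} (hA : ∀ i j, A i j ∈ regularAt hw)
    (hB : ∀ i j, B i j ∈ regularAt hw) (i : Fin m) (j : Fin l) : (A * B) i j ∈ regularAt hw :=
  sum_mem fun k _ => mul_mem (hA i k) (hB k j)

theorem toMer_mem_regularAt (hw : w ∈ Ω.carrier) (A : Matrix (Fin m) (Fin n) (Hol Ω))
    (i : Fin m) (j : Fin n) : toMer A i j ∈ regularAt hw :=
  Hol.mem_regularAt hw (A i j)

/-- Limits equal to zero become membership in the kernel of a ring homomorphism, so limits of matrix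
products are handled algebraically. -/
theorem tendstoZero_iff_exists (hw : w ∈ Ω.carrier) {f : Mer Ω} :
    f.TendstoZero w ↔ ∃ g : regularAt hw, evalRegular hw g = 0 ∧ (g : Mer Ω) = f := by
  constructor
  · intro h
    have h0 := (tendstoZero_iff hw).1 h
    exact ⟨⟨f, h0.le⟩, value_eq h, rfl⟩
  · rintro ⟨g, hg, rfl⟩
    exact (tendstoZero_iff hw).2 ((value_eq_zero_iff hw g.2).1 hg)

theorem tendstoZero_toMer_mulVec (hw : w ∈ Ω.carrier) (A : Matrix (Fin m) (Fin n) (Hol Ω))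
    {x : Fin n → Mer Ω} (hx : ∀ j, (x j).TendstoZero w) (i : Fin m) :
    ((toMer A).mulVec x i).TendstoZero w := by
  choose y hy hyx using fun j => (tendstoZero_iff_exists hw).1 (hx j)
  refine (tendstoZero_iff_exists hw).2 ⟨(A.map (Hol.toRegular hw)).mulVec y i, ?_, ?_⟩
  · rw [RingHom.map_mulVec]
    have : evalRegular hw ∘ y = 0 := funext hy
    rw [this, Matrix.mulVec_zero, Pi.zero_apply]
  · have h := (regularAt hw).subtype.map_mulVec (A.map (Hol.toRegular hw)) y i
    refine h.trans ?_
    have : (regularAt hw).subtype ∘ y = x := funext hyx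
    rw [this]
    rfl

end Evaluation

end MeroMat

namespace MeroMat

open Mer

variable {Ω : Region} {m n r : ℕ} {w : ℂ}

/-! ### Uniqueness of right coprime factorizations -/

section CoprimeFactors

/-- A left inverse of `A(w)` over `ℂ` lifts to a holomorphic `C`. Then `C A` is the identity at `w`,
hence invertible over the local ring, and `X = (C A)⁻¹ (C B)` has no pole at `w`. -/
theorem mem_regularAt_of_mul_eq {ι : Type*} [Fintype ι] (hw : w ∈ Ω.carrier)
    {A B : Matrix ι (Fin n) (Hol Ω)} {X : Matrix (Fin n) (Fin n) (Mer Ω)}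
    (hA : Function.Injective (A.map (Hol.eval hw)).mulVec)
    (h : A.map (holSubring Ω).subtype * X = B.map (holSubring Ω).subtype) (i j : Fin n) :
    X i j ∈ regularAt hw := by
  classical
  obtain ⟨L, hL⟩ := exists_leftInverse_of_mulVec_injective hA
  -- Only the values at `w` of the lifted entries matter.
  choose s hs using Hol.eval_surjective (Ω := Ω) hw
  let C : Matrix (Fin n) ι (Hol Ω) := L.map s
  have hC : C.map (Hol.eval hw) = L := by
    ext i j
    exact hs _
  let G : Matrix (Fin n) (Fin n) (regularAt hw) := (C * A).map (Hol.toRegular hw)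
  have hG : G.map (evalRegular hw) = 1 := by
    have : G.map (evalRegular hw) = (C * A).map (Hol.eval hw) := rfl
    rw [this, Matrix.map_mul, hC, hL]
  have hdet : IsUnit G.det := by
    apply isUnit_of_evalRegular_ne_zero
    rw [RingHom.map_det, RingHom.mapMatrix_apply, hG, Matrix.det_one]
    exact one_ne_zero
  have hGX : G.map (regularAt hw).subtype * X = ((C * B).map (Hol.toRegular hw)).map
      (regularAt hw).subtype := by
    have h1 : G.map (regularAt hw).subtype = (C * A).map (holSubring Ω).subtype := rfl
    have h2 : ((C * B).map (Hol.toRegular hw)).map (regularAt hw).subtype =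
      (C * B).map (holSubring Ω).subtype := rfl
    rw [h1, h2, Matrix.map_mul, Matrix.map_mul, Matrix.mul_assoc, h]
  have hX : X = (G⁻¹ * (C * B).map (Hol.toRegular hw)).map (regularAt hw).subtype := by
    rw [Matrix.map_mul, ← hGX, ← Matrix.mul_assoc, ← Matrix.map_mul, G.nonsing_inv_mul hdet,
      Matrix.map_one _ (map_zero _) (map_one _), Matrix.one_mul]
  rw [hX]
  exact Subtype.prop _

theorem exists_toMer_eq {X : Matrix (Fin m) (Fin n) (Mer Ω)}
    (hX : ∀ w, ∀ hw : w ∈ Ω.carrier, ∀ i j, X i j ∈ regularAt hw) :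
    ∃ U : Matrix (Fin m) (Fin n) (Hol Ω), toMer U = X :=
  ⟨Matrix.of fun i j => ⟨X i j, mem_holSubring_of_forall fun w hw => hX w hw i j⟩, rfl⟩

theorem exists_toMer_eq_of_mul_eq {ι : Type*} [Fintype ι]
    {A B : Matrix ι (Fin n) (Hol Ω)} {X : Matrix (Fin n) (Fin n) (Mer Ω)}
    (hA : ∀ w, ∀ hw : w ∈ Ω.carrier, Function.Injective (A.map (Hol.eval hw)).mulVec)
    (h : A.map (holSubring Ω).subtype * X = B.map (holSubring Ω).subtype) :
    ∃ U : Matrix (Fin n) (Fin n) (Hol Ω), toMer U = X :=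
  exists_toMer_eq fun _ hw => mem_regularAt_of_mul_eq hw (hA _ hw) h

theorem fromRows_map {R S κ ι₁ ι₂ : Type*} (A : Matrix ι₁ κ R) (B : Matrix ι₂ κ R) (f : R → S) :
    (Matrix.fromRows A B).map f = Matrix.fromRows (A.map f) (B.map f) := by
  ext (i | i) j <;> rfl

theorem isUnit_toMer_of_isRegularMatrix {D : Matrix (Fin n) (Fin n) (Hol Ω)}
    (hD : IsRegularMatrix D) : IsUnit (toMer D) := by
  rw [← Matrix.mulVec_injective_iff_isUnit]
  exact mulVec_injective_of_rank_eq hD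

theorem IsRightCoprimeMFD.mulVec_injective {M : Matrix (Fin m) (Fin n) (Mer Ω)}
    {N : Matrix (Fin m) (Fin n) (Hol Ω)} {D : Matrix (Fin n) (Fin n) (Hol Ω)}
    (h : IsRightCoprimeMFD M N D) (hw : w ∈ Ω.carrier) :
    Function.Injective ((Matrix.fromRows N D).map (Hol.eval hw)).mulVec := by
  rw [fromRows_map]
  exact mulVec_injective_of_rank_eq (h.coprime w hw)

theorem IsRightCoprimeMFD.mul_eq {M : Matrix (Fin m) (Fin n) (Mer Ω)}
    {N : Matrix (Fin m) (Fin n) (Hol Ω)} {D : Matrix (Fin n) (Fin n) (Hol Ω)}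
    (h : IsRightCoprimeMFD M N D) : M * toMer D = toMer N := by
  have hD := (Matrix.isUnit_iff_isUnit_det _).1 (isUnit_toMer_of_isRegularMatrix h.regular)
  rw [h.eq_mul_inv, Matrix.mul_assoc, Matrix.nonsing_inv_mul _ hD, Matrix.mul_one]

/-- A right coprime matrix-fraction description is unique up to a unimodular right factor. -/
theorem IsRightCoprimeMFD.exists_unimodular {M : Matrix (Fin m) (Fin n) (Mer Ω)}
    {N N' : Matrix (Fin m) (Fin n) (Hol Ω)} {D D' : Matrix (Fin n) (Fin n) (Hol Ω)}
    (h : IsRightCoprimeMFD M N D) (hD' : IsUnit (toMer D')) (hM : M * toMer D' = toMer N')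
    (hc : ∀ w, ∀ hw : w ∈ Ω.carrier,
      Function.Injective ((Matrix.fromRows N' D').map (Hol.eval hw)).mulVec) :
    ∃ U : GL (Fin n) (Hol Ω), N = N' * (U : Matrix (Fin n) (Fin n) (Hol Ω)) ∧
      D = D' * (U : Matrix (Fin n) (Fin n) (Hol Ω)) := by
  have hD := isUnit_toMer_of_isRegularMatrix h.regular
  rw [Matrix.isUnit_iff_isUnit_det] at hD hD'
  -- The transition matrices `D'⁻¹ D` and `D⁻¹ D'` are mutually inverse; each carries one stack to
  -- the other, so both turn out holomorphic.
  have e1 : toMer D' * ((toMer D')⁻¹ * toMer D) = toMer D := by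
    rw [← Matrix.mul_assoc, Matrix.mul_nonsing_inv _ hD', Matrix.one_mul]
  have e2 : toMer D * ((toMer D)⁻¹ * toMer D') = toMer D' := by
    rw [← Matrix.mul_assoc, Matrix.mul_nonsing_inv _ hD, Matrix.one_mul]
  have f1 : toMer N' * ((toMer D')⁻¹ * toMer D) = toMer N := by
    rw [← hM, Matrix.mul_assoc, e1, h.mul_eq]
  have f2 : toMer N * ((toMer D)⁻¹ * toMer D') = toMer N' := by
    rw [← h.mul_eq, Matrix.mul_assoc, e2, hM]
  obtain ⟨U, hU⟩ := exists_toMer_eq_of_mul_eq (B := Matrix.fromRows N D) hc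
    (X := (toMer D')⁻¹ * toMer D) (by
      rw [fromRows_map, fromRows_map, Matrix.fromRows_mul]
      exact congrArg₂ _ f1 e1)
  obtain ⟨V, hV⟩ := exists_toMer_eq_of_mul_eq (B := Matrix.fromRows N' D')
    (fun w hw => h.mulVec_injective hw) (X := (toMer D)⁻¹ * toMer D') (by
      rw [fromRows_map, fromRows_map, Matrix.fromRows_mul]
      exact congrArg₂ _ f2 e2)
  have hUV : U * V = 1 := by
    apply toMer_injective
    rw [toMer_mul, hU, hV, toMer_one, Matrix.mul_assoc, e2, Matrix.nonsing_inv_mul _ hD']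
  refine ⟨⟨U, V, hUV, mul_eq_one_comm.1 hUV⟩, ?_, ?_⟩
  · apply toMer_injective
    rw [toMer_mul, hU, f1]
  · apply toMer_injective
    rw [toMer_mul, hU, e1]

end CoprimeFactors

/-! ### Smith forms: eigenvalues and invariance of the local orders -/

section SmithForm

theorem IsSmithForm.exists_eq {A : Matrix (Fin m) (Fin n) (Hol Ω)} {φ : Fin r → Hol Ω}
    (h : IsSmithForm A φ) : ∃ (E : GL (Fin m) (Hol Ω)) (F : GL (Fin n) (Hol Ω)),
      A = (E : Matrix (Fin m) (Fin m) (Hol Ω)) * rectDiagonal m n φ *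
        (F : Matrix (Fin n) (Fin n) (Hol Ω)) := by
  obtain ⟨E, F, hEF⟩ := h.equivalent
  refine ⟨E, F, toMer_injective ?_⟩
  rw [hEF, toMer_mul, toMer_mul, toMer_rectDiagonal]

theorem IsSmithForm.le_rows {A : Matrix (Fin m) (Fin n) (Hol Ω)} {φ : Fin r → Hol Ω}
    (h : IsSmithForm A φ) : r ≤ m := by
  rw [← h.nrank_eq]
  exact Matrix.rank_le_height _

theorem IsSmithForm.le_cols {A : Matrix (Fin m) (Fin n) (Hol Ω)} {φ : Fin r → Hol Ω}
    (h : IsSmithForm A φ) : r ≤ n := by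
  rw [← h.nrank_eq]
  exact Matrix.rank_le_width _

/-- A matrix equivalent to `diag(φ_1, …, φ_r) ⊕ 0` has that Smith form. -/
theorem isSmithForm_of_eq (hm : r ≤ m) (hn : r ≤ n) {A : Matrix (Fin m) (Fin n) (Hol Ω)}
    {φ : Fin r → Hol Ω} (h0 : ∀ j, φ j ≠ 0) (hdvd : ∀ i j, i ≤ j → φ i ∣ φ j)
    (E : GL (Fin m) (Hol Ω)) (F : GL (Fin n) (Hol Ω))
    (h : A = (E : Matrix (Fin m) (Fin m) (Hol Ω)) * rectDiagonal m n φ *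
      (F : Matrix (Fin n) (Fin n) (Hol Ω))) : IsSmithForm A φ := by
  have hA : toMer A = toMer (E : Matrix (Fin m) (Fin m) (Hol Ω)) *
      (rectDiag m n fun j => (φ j : Mer Ω)) * toMer (F : Matrix (Fin n) (Fin n) (Hol Ω)) := by
    rw [h, toMer_mul, toMer_mul, toMer_rectDiagonal]
  refine ⟨?_, h0, hdvd, E, F, hA⟩
  rw [nrank, hA, rank_mul_mul_of_isUnit (isUnit_toMer E) (isUnit_toMer F),
    rectDiag_eq_rectDiagonal]
  exact rank_rectDiagonal_of_ne_zero hm hn fun j hj => h0 j (Subtype.ext hj)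

theorem IsSmithForm.eigenvalues_eq {A : Matrix (Fin m) (Fin n) (Hol Ω)} {φ : Fin r → Hol Ω}
    (h : IsSmithForm A φ) :
    eigenvalues A = {w | w ∈ Ω.carrier ∧ ∃ j, (φ j : Mer Ω).value w = 0} := by
  obtain ⟨E, F, hA⟩ := h.exists_eq
  ext w
  refine and_congr_right fun hw => ?_
  rw [h.nrank_eq, evalAt_toMer hw, hA, Matrix.map_mul, Matrix.map_mul,
    rank_mul_mul_of_isUnit (isUnit_map_eval hw E) (isUnit_map_eval hw F),
    rectDiagonal_map _ _ (map_zero _), rank_rectDiagonal_lt_iff h.le_rows h.le_cols]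
  rfl

/-- Two Smith forms are related by `P diag(φ) = diag(χ) Q` with `P`, `Q` unimodular. If `ord χ_k >
ord φ_k` at `w`, then for `j ≤ k ≤ i < r` the relation `P_ij φ_j = χ_i Q_ij` and the divisibility
chains give `ord P_ij > 0`. So `P(w)` has a zero block that forces its determinant to vanish. -/
theorem IsSmithForm.order_le {A : Matrix (Fin m) (Fin n) (Hol Ω)} {φ χ : Fin r → Hol Ω}
    (hφ : IsSmithForm A φ) (hχ : IsSmithForm A χ) (hw : w ∈ Ω.carrier) (k : Fin r) :
    (χ k : Mer Ω).order w ≤ (φ k : Mer Ω).order w := by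
  by_contra! hlt
  obtain ⟨E, F, hA⟩ := hφ.exists_eq
  obtain ⟨E', F', hA'⟩ := hχ.exists_eq
  let P : GL (Fin m) (Hol Ω) := E'⁻¹ * E
  let Q : GL (Fin n) (Hol Ω) := F' * F⁻¹
  have hPQ : (P : Matrix (Fin m) (Fin m) (Hol Ω)) * rectDiagonal m n φ =
      rectDiagonal m n χ * (Q : Matrix (Fin n) (Fin n) (Hol Ω)) := by
    have h1 : (P : Matrix (Fin m) (Fin m) (Hol Ω)) * rectDiagonal m n φ =
        ((E'⁻¹ : GL (Fin m) (Hol Ω)) : Matrix (Fin m) (Fin m) (Hol Ω)) * A *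
          ((F⁻¹ : GL (Fin n) (Hol Ω)) : Matrix (Fin n) (Fin n) (Hol Ω)) := by
      rw [hA, Units.val_mul]
      simp only [Matrix.mul_assoc]
      rw [F.mul_inv, Matrix.mul_one]
    rw [h1, hA', Units.val_mul]
    simp only [← Matrix.mul_assoc]
    rw [E'.inv_mul, Matrix.one_mul]
  have hm := hφ.le_rows
  have hn := hφ.le_cols
  have hdet := (Matrix.isUnit_iff_isUnit_det _).1 (isUnit_map_eval hw P)
  refine hdet.ne_zero (det_eq_zero_of_zero_block (Fin.castLE hm k) fun i j hi hj => ?_)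
  rw [Matrix.map_apply, Hol.eval_eq_zero_iff]
  have hjr : (j : ℕ) < r := lt_of_le_of_lt hj k.2
  have key := congrFun (congrFun hPQ i) ⟨j, hjr.trans_le hn⟩
  rw [mul_rectDiagonal_apply hm, dif_pos hjr, rectDiagonal_mul_apply hn] at key
  have hφj : (φ ⟨j, hjr⟩ : Mer Ω) ≠ 0 := fun h => hφ.ne_zero _ (Subtype.ext h)
  have hle : (φ ⟨j, hjr⟩ : Mer Ω).order w ≤ (φ k : Mer Ω).order w :=
    Hol.order_le_of_dvd hw (hφ.dvd ⟨j, hjr⟩ k hj)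
  split_ifs at key with hir
  · have hle' : (χ k : Mer Ω).order w ≤ (χ ⟨i, hir⟩ : Mer Ω).order w :=
      Hol.order_le_of_dvd hw (hχ.dvd k ⟨i, hir⟩ hi)
    have hdvd : (χ ⟨i, hir⟩ : Mer Ω).order w ≤
        ((P : Matrix (Fin m) (Fin m) (Hol Ω)) i j * φ ⟨j, hjr⟩ : Hol Ω).1.order w :=
      Hol.order_le_of_dvd hw ⟨_, key⟩
    rw [show ((P : Matrix (Fin m) (Fin m) (Hol Ω)) i j * φ ⟨j, hjr⟩ : Hol Ω).1 =
      ((P : Matrix (Fin m) (Fin m) (Hol Ω)) i j : Mer Ω) * φ ⟨j, hjr⟩ from rfl,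
      order_mul _ _ hw] at hdvd
    by_contra hneg
    refine absurd (hdvd.trans (add_le_add_left (not_lt.1 hneg) _)) ?_
    rw [zero_add]
    exact not_le.2 ((hle.trans_lt hlt).trans_le hle')
  -- Row `i` of `diag(χ) ⊕ 0` is zero here, so `P_ij φ_j = 0`.
  · have h0 : (P : Matrix (Fin m) (Fin m) (Hol Ω)) i j = 0 := by
      rcases mul_eq_zero.1 key with h | h
      · exact h
      · exact absurd h (hφ.ne_zero _)
    have h1 := (order_eq_top_iff (f := (0 : Mer Ω)) hw).2 rfl
    have h2 : (((P : Matrix (Fin m) (Fin m) (Hol Ω)) i j : Hol Ω) : Mer Ω) = 0 := by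
      rw [h0]
      rfl
    rw [h2, h1]
    exact WithTop.coe_lt_top 0

/-- The orders of the invariant functions at a point do not depend on the Smith form chosen. -/
theorem IsSmithForm.divisor_eq {A : Matrix (Fin m) (Fin n) (Hol Ω)} {φ χ : Fin r → Hol Ω}
    (hφ : IsSmithForm A φ) (hχ : IsSmithForm A χ) (hw : w ∈ Ω.carrier) (k : Fin r) :
    (φ k : Mer Ω).divisor w = (χ k : Mer Ω).divisor w :=
  congrArg WithTop.untop₀ (le_antisymm (hχ.order_le hφ hw k) (hφ.order_le hχ hw k))

/-- The index is defined through an arbitrary choice of Smith form; invariance of the orders removes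
the choice. -/
theorem IsSmithForm.smithZeroIndex_eq {A : Matrix (Fin m) (Fin n) (Hol Ω)} {φ : Fin r → Hol Ω}
    (h : IsSmithForm A φ) (hw : w ∈ Ω.carrier) :
    smithZeroIndex A w = List.ofFn fun j => (φ j : Mer Ω).divisor w := by
  obtain rfl := h.nrank_eq
  have hex : ∃ φ : Fin (nrank (toMer A)) → Hol Ω, IsSmithForm A φ := ⟨φ, h⟩
  rw [smithZeroIndex, dif_pos hex]
  exact congrArg _ (funext fun j => hex.choose_spec.divisor_eq h hw j)

end SmithForm

end MeroMat

namespace MeroMat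

open Mer

variable {Ω : Region} {m n r : ℕ} {w : ℂ}

/-! ### Reversing the invariant pole functions -/

section OnesThenReverse

/-- Read backwards the sequence is `(ψ_1, …, ψ_r, 1, …, 1)`, the order in which it cancels the
denominators of the Smith–McMillan form. -/
theorem onesThenReverse_rev_of_lt (ψ : Fin r → Hol Ω) (i : Fin n) (h : (i : ℕ) < r) :
    onesThenReverse n ψ (Fin.rev i) = ψ ⟨i, h⟩ := by
  have hi : n - 1 - (Fin.rev i : ℕ) = i := by
    rw [Fin.val_rev]
    omega
  simp only [onesThenReverse, hi, h, dif_pos]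

theorem onesThenReverse_rev_of_le (ψ : Fin r → Hol Ω) (i : Fin n) (h : r ≤ (i : ℕ)) :
    onesThenReverse n ψ (Fin.rev i) = 1 := by
  have hi : n - 1 - (Fin.rev i : ℕ) = i := by
    rw [Fin.val_rev]
    omega
  simp only [onesThenReverse, hi, not_lt.2 h, dif_neg, not_false_eq_true]

theorem forall_onesThenReverse {p : Hol Ω → Prop} {ψ : Fin r → Hol Ω} (h1 : p 1)
    (hψ : ∀ j, p (ψ j)) (i : Fin n) : p (onesThenReverse n ψ i) := by
  unfold onesThenReverse
  split_ifs
  · exact hψ _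
  · exact h1

theorem onesThenReverse_dvd {ψ : Fin r → Hol Ω} (h : ∀ i j, i ≤ j → ψ j ∣ ψ i) (i j : Fin n)
    (hij : i ≤ j) : onesThenReverse n ψ i ∣ onesThenReverse n ψ j := by
  have hij' : (i : ℕ) ≤ j := hij
  unfold onesThenReverse
  split_ifs with h1 h2
  · exact h _ _ (by rw [Fin.mk_le_mk]; omega)
  · omega
  · exact one_dvd _
  · exact one_dvd _

theorem ofFn_onesThenReverse {α : Type*} (hn : r ≤ n) (ψ : Fin r → Hol Ω) (f : Hol Ω → α) :
    (List.ofFn fun i => f (onesThenReverse n ψ i)) =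
      List.replicate (n - r) (f 1) ++ (List.ofFn fun j => f (ψ j)).reverse := by
  refine List.ext_getElem (by simp; omega) fun i hi _ => ?_
  rw [List.length_ofFn] at hi
  rw [List.getElem_ofFn, List.getElem_append]
  split_ifs with h
  · rw [List.length_replicate] at h
    rw [List.getElem_replicate, onesThenReverse, dif_neg (by simp only; omega)]
  · rw [List.length_replicate] at h
    have hlt : n - 1 - i < r := by omega
    have he : r - 1 - (i - (n - r)) = n - 1 - i := by omega
    rw [onesThenReverse, dif_pos hlt]
    simp [he]

/-- The permutation matrix that reverses the order of the coordinates. -/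
def reversal (R : Type*) [Zero R] [One R] (n : ℕ) : Matrix (Fin n) (Fin n) R :=
  Matrix.of fun i j => if j = Fin.rev i then 1 else 0

theorem reversal_mul_diagonal_mul_reversal {R : Type*} [CommRing R] (d : Fin n → R) :
    reversal R n * Matrix.diagonal d * reversal R n = Matrix.diagonal fun i => d (Fin.rev i) := by
  ext i j
  rw [Matrix.mul_apply, Matrix.diagonal_apply, Finset.sum_eq_single (Fin.rev i)]
  · simp [reversal, Matrix.mul_diagonal, eq_comm]
  · intro b _ hb
    simp [reversal, Matrix.mul_diagonal, hb]
  · simp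

theorem reversal_mul_reversal (R : Type*) [CommRing R] : reversal R n * reversal R n = 1 := by
  have h := reversal_mul_diagonal_mul_reversal (fun _ : Fin n => (1 : R))
  rwa [Matrix.diagonal_one, Matrix.mul_one] at h

/-- The reversal of coordinates as an invertible matrix. -/
def reversalGL (R : Type*) [CommRing R] (n : ℕ) : GL (Fin n) R :=
  ⟨reversal R n, reversal R n, reversal_mul_reversal R, reversal_mul_reversal R⟩

end OnesThenReverse

/-! ### Smith forms of the numerator and the denominator -/

section SmithMcMillan

variable {M : Matrix (Fin m) (Fin n) (Mer Ω)} {N : Matrix (Fin m) (Fin n) (Hol Ω)}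
  {D : Matrix (Fin n) (Fin n) (Hol Ω)} {φ ψ : Fin r → Hol Ω}

theorem IsSmithMcMillanForm.le_rows (h : IsSmithMcMillanForm M φ ψ) : r ≤ m := by
  rw [← h.nrank_eq]
  exact Matrix.rank_le_height _

theorem IsSmithMcMillanForm.le_cols (h : IsSmithMcMillanForm M φ ψ) : r ≤ n := by
  rw [← h.nrank_eq]
  exact Matrix.rank_le_width _

theorem IsSmithMcMillanForm.pole_coe_ne_zero (h : IsSmithMcMillanForm M φ ψ) (j : Fin r) :
    (ψ j : Mer Ω) ≠ 0 := fun h0 => h.pole_ne_zero j (Subtype.ext h0)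

theorem IsSmithMcMillanForm.zero_coe_ne_zero (h : IsSmithMcMillanForm M φ ψ) (j : Fin r) :
    (φ j : Mer Ω) ≠ 0 := fun h0 => h.zero_ne_zero j (Subtype.ext h0)

/-- The numerator and denominator of a right coprime matrix-fraction description are diagonalized by
column operations in common, with the invariant zero and pole functions on the diagonals. -/
theorem IsSmithMcMillanForm.exists_factorization (h : IsSmithMcMillanForm M φ ψ)
    (hMFD : IsRightCoprimeMFD M N D) :
    ∃ (E : GL (Fin m) (Hol Ω)) (F U : GL (Fin n) (Hol Ω)),
      N = (E : Matrix (Fin m) (Fin m) (Hol Ω)) * rectDiagonal m n φ *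
        (U : Matrix (Fin n) (Fin n) (Hol Ω)) ∧
      D = (F : Matrix (Fin n) (Fin n) (Hol Ω)) *
        Matrix.diagonal (fun i => onesThenReverse n ψ (Fin.rev i)) *
        (U : Matrix (Fin n) (Fin n) (Hol Ω)) := by
  obtain ⟨E, F, hM⟩ := h.equivalent
  have hm := h.le_rows
  have hn := h.le_cols
  have hdiag : toMer (Matrix.diagonal fun i => onesThenReverse n ψ (Fin.rev i)) =
      Matrix.diagonal fun i => (onesThenReverse n ψ (Fin.rev i) : Mer Ω) :=
    Matrix.diagonal_map (map_zero (holSubring Ω).subtype)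
  refine (?_ : ∃ U : GL (Fin n) (Hol Ω), _).elim fun U hU => ⟨E, F⁻¹, U, hU⟩
  -- The reference factorization is `N' = E (diag(φ) ⊕ 0)` and `D' = F⁻¹ diag(ψ_1, …, ψ_r, 1, …,
  -- 1)`. It remains to see that `D'` is invertible, that `M D' = N'`, and that the stack is
  -- injective at each point.
  refine hMFD.exists_unimodular ?_ ?_ ?_
  · rw [toMer_mul, hdiag]
    refine (isUnit_toMer _).mul ?_
    rw [Matrix.isUnit_iff_isUnit_det, Matrix.det_diagonal, isUnit_iff_ne_zero]
    refine Finset.prod_ne_zero_iff.2 fun i _ h0 => ?_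
    exact forall_onesThenReverse (p := fun f => f ≠ 0) (one_ne_zero (α := Hol Ω)) h.pole_ne_zero (Fin.rev i)
      (Subtype.ext h0)
  · have hφ : (rectDiag m n fun j => (φ j : Mer Ω) / (ψ j : Mer Ω)) *
        Matrix.diagonal (fun i => (onesThenReverse n ψ (Fin.rev i) : Mer Ω)) =
        rectDiag m n fun j => (φ j : Mer Ω) := by
      rw [rectDiag_eq_rectDiagonal, rectDiagonal_mul_diagonal hn, rectDiag_eq_rectDiagonal]
      congr 1
      funext j
      rw [onesThenReverse_rev_of_lt ψ (Fin.castLE hn j) j.2]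
      exact div_mul_cancel₀ _ (h.pole_coe_ne_zero j)
    rw [hM, toMer_mul, toMer_mul, hdiag, toMer_rectDiagonal, ← hφ]
    simp only [Matrix.mul_assoc]
    rw [← Matrix.mul_assoc (toMer (F : Matrix (Fin n) (Fin n) (Hol Ω))), toMer_mul_inv,
      Matrix.one_mul]
  · intro w hw
    rw [← Matrix.coe_mulVecLin, ← LinearMap.ker_eq_bot, LinearMap.ker_eq_bot']
    intro x hx
    rw [Matrix.mulVecLin_apply, fromRows_map, Matrix.fromRows_mulVec] at hx
    have hx1 := congrArg (fun y => y ∘ Sum.inl) hx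
    have hx2 := congrArg (fun y => y ∘ Sum.inr) hx
    simp only [Sum.elim_comp_inl, Sum.elim_comp_inr] at hx1 hx2
    rw [Matrix.map_mul, ← Matrix.mulVec_mulVec] at hx1 hx2
    have hy1 := Matrix.mulVec_injective_of_isUnit (isUnit_map_eval hw E)
      (hx1.trans (Matrix.mulVec_zero _).symm)
    have hy2 := Matrix.mulVec_injective_of_isUnit (isUnit_map_eval hw F⁻¹)
      (hx2.trans (Matrix.mulVec_zero _).symm)
    rw [rectDiagonal_map _ _ (map_zero _)] at hy1
    rw [Matrix.diagonal_map (map_zero _)] at hy2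
    funext i
    have hi2 := congrFun hy2 i
    rw [Matrix.mulVec_diagonal] at hi2
    -- For `i < r` both `φ_i(w) x_i` and `ψ_i(w) x_i` vanish while `φ_i(w)`, `ψ_i(w)` are not both
    -- zero; for `i ≥ r` the diagonal entry of `D'` is `1`.
    by_cases hi : (i : ℕ) < r
    · have hi1 := congrFun hy1 ⟨i, hi.trans_le hm⟩
      rw [rectDiagonal_mulVec hn, dif_pos hi] at hi1
      simp only [onesThenReverse_rev_of_lt ψ i hi] at hi2
      rcases mul_eq_zero.1 hi1 with h0 | h0
      · exact (mul_eq_zero.1 hi2).resolve_left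
          (Hol.eval_ne_zero_of_isRelPrime hw (h.relPrime ⟨i, hi⟩) h0)
      · exact h0
    · simp only [onesThenReverse_rev_of_le ψ i (not_lt.1 hi), map_one] at hi2
      simpa using hi2

theorem IsSmithMcMillanForm.isSmithForm_numerator (h : IsSmithMcMillanForm M φ ψ)
    (hMFD : IsRightCoprimeMFD M N D) : IsSmithForm N φ := by
  obtain ⟨E, F, U, hN, -⟩ := h.exists_factorization hMFD
  exact isSmithForm_of_eq h.le_rows h.le_cols h.zero_ne_zero h.zero_dvd E U hN

theorem IsSmithMcMillanForm.isSmithForm_denominator (h : IsSmithMcMillanForm M φ ψ)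
    (hMFD : IsRightCoprimeMFD M N D) : IsSmithForm D (onesThenReverse n ψ) := by
  obtain ⟨E, F, U, -, hD⟩ := h.exists_factorization hMFD
  refine isSmithForm_of_eq le_rfl le_rfl
    (forall_onesThenReverse (p := fun f => f ≠ 0) (one_ne_zero (α := Hol Ω)) h.pole_ne_zero)
    -- Since `ψ_j ∣ ψ_i` for `i ≤ j`, the diagonal of the factorization runs against the
    -- divisibility order of a Smith form; conjugation by the reversal turns it around.
    (onesThenReverse_dvd h.pole_dvd) (F * reversalGL (Hol Ω) n) (reversalGL (Hol Ω) n * U) ?_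
  rw [hD, ← reversal_mul_diagonal_mul_reversal, rectDiagonal_self, Units.val_mul, Units.val_mul]
  simp only [Matrix.mul_assoc]
  rfl

/-- Whichever Smith–McMillan form the definition picks, its zero functions form a Smith form of `N`.
Uniqueness for `N` therefore suffices. -/
theorem IsSmithMcMillanForm.zeroIndex_eq (h : IsSmithMcMillanForm M φ ψ)
    (hMFD : IsRightCoprimeMFD M N D) (hw : w ∈ Ω.carrier) :
    zeroIndex M w = smithZeroIndex N w := by
  obtain rfl := h.nrank_eq
  have hex : ∃ p : (Fin (nrank M) → Hol Ω) × (Fin (nrank M) → Hol Ω),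
      IsSmithMcMillanForm M p.1 p.2 := ⟨(φ, ψ), h⟩
  rw [zeroIndex, dif_pos hex,
    (hex.choose_spec.isSmithForm_numerator hMFD).smithZeroIndex_eq hw]

theorem IsSmithMcMillanForm.smithZeroIndex_denominator (h : IsSmithMcMillanForm M φ ψ)
    (hMFD : IsRightCoprimeMFD M N D) (hw : w ∈ Ω.carrier) :
    smithZeroIndex D w = List.replicate (n - r) 0 ++ (poleIndex M w).reverse := by
  obtain rfl := h.nrank_eq
  have hex : ∃ p : (Fin (nrank M) → Hol Ω) × (Fin (nrank M) → Hol Ω),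
      IsSmithMcMillanForm M p.1 p.2 := ⟨(φ, ψ), h⟩
  have h1 : ((1 : Hol Ω) : Mer Ω).divisor w = 0 := congrArg WithTop.untop₀ (order_one hw)
  rw [poleIndex, dif_pos hex,
    (hex.choose_spec.isSmithForm_denominator hMFD).smithZeroIndex_eq hw,
    ofFn_onesThenReverse h.le_cols _ (fun f : Hol Ω => (f : Mer Ω).divisor w), h1]

/-! ### Poles, zeros and eigenpoles in terms of the invariant functions -/

theorem exists_onesThenReverse_value_eq_zero_iff (hn : r ≤ n) (ψ : Fin r → Hol Ω)
    (hw : w ∈ Ω.carrier) :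
    (∃ i, (onesThenReverse n ψ i : Mer Ω).value w = 0) ↔ ∃ j, (ψ j : Mer Ω).value w = 0 := by
  constructor
  · rintro ⟨i, hi⟩
    by_contra hψ
    have h1 : Hol.eval hw 1 ≠ 0 := Hol.eval_ne_zero_of_isUnit hw isUnit_one
    exact forall_onesThenReverse (p := fun f => Hol.eval hw f ≠ 0) h1
      (fun j hj => hψ ⟨j, hj⟩) i hi
  · rintro ⟨j, hj⟩
    exact ⟨Fin.rev (Fin.castLE hn j), by rwa [onesThenReverse_rev_of_lt ψ (Fin.castLE hn j) j.2]⟩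

theorem IsSmithMcMillanForm.value_zero_ne_zero (h : IsSmithMcMillanForm M φ ψ)
    (hw : w ∈ Ω.carrier) {j : Fin r} (hj : (ψ j : Mer Ω).value w = 0) :
    (φ j : Mer Ω).value w ≠ 0 := fun h0 =>
  Hol.eval_ne_zero_of_isRelPrime hw (h.relPrime j) h0 hj

/-- If the quotient were regular where `ψ_j` vanishes, then `φ_j = (φ_j/ψ_j) ψ_j` would vanish there
too, against relative primality. -/
theorem IsSmithMcMillanForm.div_mem_regularAt_iff (h : IsSmithMcMillanForm M φ ψ)
    (hw : w ∈ Ω.carrier) (j : Fin r) :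
    (φ j : Mer Ω) / (ψ j : Mer Ω) ∈ regularAt hw ↔ (ψ j : Mer Ω).value w ≠ 0 := by
  constructor
  · intro hmem h0
    apply h.value_zero_ne_zero hw h0
    have h1 := map_mul (evalRegular hw) ⟨_, hmem⟩ (Hol.toRegular hw (ψ j))
    have h2 : (⟨_, hmem⟩ : regularAt hw) * Hol.toRegular hw (ψ j) = Hol.toRegular hw (φ j) :=
      Subtype.ext (div_mul_cancel₀ _ (h.pole_coe_ne_zero j))
    have h3 : evalRegular hw (Hol.toRegular hw (ψ j)) = 0 := h0
    rw [h2, h3, mul_zero] at h1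
    exact h1
  · intro h0
    rw [div_eq_mul_inv]
    exact mul_mem (Hol.mem_regularAt hw _) (inv_mem_regularAt hw (Hol.mem_regularAt hw _) h0)

theorem IsSmithMcMillanForm.value_div_eq_zero_iff (h : IsSmithMcMillanForm M φ ψ)
    (hw : w ∈ Ω.carrier) {j : Fin r} (hj : (ψ j : Mer Ω).value w ≠ 0) :
    ((φ j : Mer Ω) / (ψ j : Mer Ω)).value w = 0 ↔ (φ j : Mer Ω).value w = 0 := by
  have hmem := (h.div_mem_regularAt_iff hw j).2 hj
  have h1 := map_mul (evalRegular hw) ⟨_, hmem⟩ (Hol.toRegular hw (ψ j))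
  have h2 : (⟨_, hmem⟩ : regularAt hw) * Hol.toRegular hw (ψ j) = Hol.toRegular hw (φ j) :=
    Subtype.ext (div_mul_cancel₀ _ (h.pole_coe_ne_zero j))
  rw [h2] at h1
  have h3 : (φ j : Mer Ω).value w =
      ((φ j : Mer Ω) / (ψ j : Mer Ω)).value w * (ψ j : Mer Ω).value w := h1
  rw [h3, mul_eq_zero, or_iff_left hj]

theorem IsSmithMcMillanForm.rectDiag_mem_regularAt (h : IsSmithMcMillanForm M φ ψ)
    (hw : w ∈ Ω.carrier) (hψ : ∀ j, (ψ j : Mer Ω).value w ≠ 0) (i : Fin m) (j : Fin n) :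
    rectDiag m n (fun j => (φ j : Mer Ω) / (ψ j : Mer Ω)) i j ∈ regularAt hw := by
  rw [rectDiag, Matrix.of_apply]
  split_ifs
  · exact (h.div_mem_regularAt_iff hw _).2 (hψ _)
  · exact zero_mem _

/-- Multiplication by `E`, `F` and by their inverses preserves regularity at `w`, so `M` and its
diagonal form have the same poles. -/
theorem IsSmithMcMillanForm.poles_eq (h : IsSmithMcMillanForm M φ ψ) :
    poles M = {w | w ∈ Ω.carrier ∧ ∃ j, (ψ j : Mer Ω).value w = 0} := by
  obtain ⟨E, F, hM⟩ := h.equivalent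
  ext w
  refine and_congr_right fun hw => ?_
  rw [← not_iff_not]
  simp only [isPole_iff hw, not_exists, not_not]
  constructor
  · intro hreg j
    rw [← ne_eq, ← h.div_mem_regularAt_iff hw]
    have hΔ : rectDiag m n (fun j => (φ j : Mer Ω) / (ψ j : Mer Ω)) =
        toMer ((E⁻¹ : GL (Fin m) (Hol Ω)) : Matrix (Fin m) (Fin m) (Hol Ω)) * M *
          toMer ((F⁻¹ : GL (Fin n) (Hol Ω)) : Matrix (Fin n) (Fin n) (Hol Ω)) := by
      rw [hM]
      simp only [Matrix.mul_assoc]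
      rw [toMer_mul_inv, Matrix.mul_one, ← Matrix.mul_assoc, toMer_inv_mul, Matrix.one_mul]
    have hij := mul_mem_regularAt hw
      (mul_mem_regularAt hw
        (toMer_mem_regularAt hw ((E⁻¹ : GL (Fin m) (Hol Ω)) : Matrix (Fin m) (Fin m) (Hol Ω))) hreg)
      (toMer_mem_regularAt hw ((F⁻¹ : GL (Fin n) (Hol Ω)) : Matrix (Fin n) (Fin n) (Hol Ω)))
      (Fin.castLE h.le_rows j) (Fin.castLE h.le_cols j)
    rw [← hΔ] at hij
    simpa [rectDiag] using hij
  · intro hψ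
    rw [hM]
    exact mul_mem_regularAt hw (mul_mem_regularAt hw (toMer_mem_regularAt hw _)
      (h.rectDiag_mem_regularAt hw hψ)) (toMer_mem_regularAt hw _)

theorem IsSmithMcMillanForm.rank_evalAt_lt_iff (h : IsSmithMcMillanForm M φ ψ)
    (hw : w ∈ Ω.carrier) (hψ : ∀ j, (ψ j : Mer Ω).value w ≠ 0) :
    (evalAt M w).rank < nrank M ↔ ∃ j, (φ j : Mer Ω).value w = 0 := by
  obtain ⟨E, F, hM⟩ := h.equivalent
  have hΔ := h.rectDiag_mem_regularAt hw hψ (m := m) (n := n)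
  have hE := toMer_mem_regularAt hw (E : Matrix (Fin m) (Fin m) (Hol Ω))
  have hF := toMer_mem_regularAt hw (F : Matrix (Fin n) (Fin n) (Hol Ω))
  have hEv : evalAt M w = (E : Matrix (Fin m) (Fin m) (Hol Ω)).map (Hol.eval hw) *
      (rectDiagonal m n fun j => ((φ j : Mer Ω) / (ψ j : Mer Ω)).value w) *
      (F : Matrix (Fin n) (Fin n) (Hol Ω)).map (Hol.eval hw) := by
    rw [hM, evalAt_mul hw (mul_mem_regularAt hw hE hΔ) hF, evalAt_mul hw hE hΔ,
      evalAt_rectDiag hw, evalAt_toMer hw, evalAt_toMer hw]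
  rw [h.nrank_eq, hEv, rank_mul_mul_of_isUnit (isUnit_map_eval hw E) (isUnit_map_eval hw F),
    rank_rectDiagonal_lt_iff h.le_rows h.le_cols]
  exact exists_congr fun j => h.value_div_eq_zero_iff hw (hψ j)

/-- The witness is `f = F⁻¹ e_j`: then `M f = E (φ_j/ψ_j) e_j` tends to `0`, since `ψ_j(w) ≠ 0`. -/
theorem IsSmithMcMillanForm.mem_eigenpoles (h : IsSmithMcMillanForm M φ ψ) (hw : w ∈ poles M)
    {j : Fin r} (hj : (φ j : Mer Ω).value w = 0) : w ∈ eigenpoles M := by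
  obtain ⟨E, F, hM⟩ := h.equivalent
  have hwΩ := hw.1
  have hn := h.le_cols
  have hψj : (ψ j : Mer Ω).value w ≠ 0 := fun h0 => h.value_zero_ne_zero hwΩ h0 hj
  let e : Fin n → Hol Ω := Pi.single (Fin.castLE hn j) 1
  let f := ((F⁻¹ : GL (Fin n) (Hol Ω)) : Matrix (Fin n) (Fin n) (Hol Ω)).mulVec e
  have hFf : (F : Matrix (Fin n) (Fin n) (Hol Ω)).mulVec f = e := by
    simp only [f]
    rw [Matrix.mulVec_mulVec, F.mul_inv, Matrix.one_mulVec]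
  refine ⟨hw, f, ?_, ?_⟩
  · intro v hv hfv
    -- A null vector `v` has `(F v)_j = 0` because `φ_j/ψ_j ≠ 0`, whereas `(F f)_j = 1`; so their
    -- values at `w` differ.
    have hFv : (F : Matrix (Fin n) (Fin n) (Hol Ω)).mulVec v (Fin.castLE hn j) = 0 := by
      rw [hM, ← Matrix.mulVec_mulVec, ← Matrix.mulVec_mulVec, toMer_mulVec] at hv
      have h1 := Matrix.mulVec_injective_of_isUnit (isUnit_toMer E)
        (hv.trans (Matrix.mulVec_zero _).symm)
      have h2 := congrFun h1 (Fin.castLE h.le_rows j)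
      rw [rectDiag_eq_rectDiagonal, rectDiagonal_mulVec hn,
        dif_pos (show (Fin.castLE h.le_rows j : ℕ) < r from j.2)] at h2
      exact Subtype.ext ((mul_eq_zero.1 h2).resolve_left
        (div_ne_zero (h.zero_coe_ne_zero j) (h.pole_coe_ne_zero j)))
    have hval : (Hol.eval hwΩ) ∘ f = (Hol.eval hwΩ) ∘ v := hfv
    have h3 := RingHom.map_mulVec (Hol.eval hwΩ) (F : Matrix (Fin n) (Fin n) (Hol Ω)) f
      (Fin.castLE hn j)
    rw [hval, ← RingHom.map_mulVec, hFv, hFf] at h3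
    simp [e] at h3
  · rw [hM, ← Matrix.mulVec_mulVec, ← Matrix.mulVec_mulVec, toMer_mulVec, hFf]
    refine tendstoZero_toMer_mulVec hwΩ _ fun i => ?_
    have hz : (0 : Mer Ω).TendstoZero w :=
      (tendstoZero_iff_exists hwΩ).2 ⟨0, map_zero _, rfl⟩
    rw [rectDiag_eq_rectDiagonal, rectDiagonal_mulVec hn]
    split_ifs with hi
    · by_cases hij : (⟨i, hi⟩ : Fin r) = j
      · have he : e ⟨i, hi.trans_le hn⟩ = 1 := by
          subst hij
          exact Pi.single_eq_same (M := fun _ => Hol Ω) _ _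
        rw [he, hij]
        refine (tendstoZero_iff_exists hwΩ).2
          ⟨⟨_, (h.div_mem_regularAt_iff hwΩ j).2 hψj⟩, (h.value_div_eq_zero_iff hwΩ hψj).2 hj, ?_⟩
        exact (mul_one _).symm
      · have he : e ⟨i, hi.trans_le hn⟩ = 0 := by
          refine Pi.single_eq_of_ne (M := fun _ => Hol Ω) (fun h' => hij ?_) _
          exact Fin.ext (show i = (j : ℕ) from congrArg (fun k : Fin n => (k : ℕ)) h')
        rw [he, show ((0 : Hol Ω) : Mer Ω) = 0 from rfl, mul_zero]
        exact hz
    · exact hz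

/-- If no `φ_j` vanishes at `w`, then `M f → 0` forces the first `r` coordinates of `F f` to vanish
at `w`. Replacing them by zero gives a null vector with the same value as `f` at `w`, which an
eigenpole excludes. -/
theorem IsSmithMcMillanForm.exists_value_eq_zero_of_mem_eigenpoles
    (h : IsSmithMcMillanForm M φ ψ) (hw : w ∈ eigenpoles M) :
    ∃ j, (φ j : Mer Ω).value w = 0 := by
  by_contra! hφ
  obtain ⟨E, F, hM⟩ := h.equivalent
  obtain ⟨⟨hwΩ, -⟩, f, hf, hMf⟩ := hw
  have hn := h.le_cols
  let g := (F : Matrix (Fin n) (Fin n) (Hol Ω)).mulVec f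
  have hΔg (i : Fin m) : ((rectDiag m n fun j => (φ j : Mer Ω) / (ψ j : Mer Ω)).mulVec
      (fun j => (g j : Mer Ω)) i).TendstoZero w := by
    have h1 := tendstoZero_toMer_mulVec hwΩ
      ((E⁻¹ : GL (Fin m) (Hol Ω)) : Matrix (Fin m) (Fin m) (Hol Ω)) hMf i
    rw [hM, ← Matrix.mulVec_mulVec, ← Matrix.mulVec_mulVec, toMer_mulVec, Matrix.mulVec_mulVec,
      toMer_inv_mul, Matrix.one_mulVec] at h1
    exact h1
  have hg (i : Fin n) (hi : (i : ℕ) < r) : Hol.eval hwΩ (g i) = 0 := by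
    have h1 := hΔg ⟨i, hi.trans_le h.le_rows⟩
    rw [rectDiag_eq_rectDiagonal, rectDiagonal_mulVec hn, dif_pos hi] at h1
    obtain ⟨x, hx0, hx⟩ := (tendstoZero_iff_exists hwΩ).1 h1
    -- `ψ_i` may vanish at `w`, so the denominator is cleared before evaluating.
    have h2 : x * Hol.toRegular hwΩ (ψ ⟨i, hi⟩) = Hol.toRegular hwΩ (φ ⟨i, hi⟩ * g i) := by
      refine Subtype.ext ?_
      change (x : Mer Ω) * (ψ ⟨i, hi⟩ : Mer Ω) = (φ ⟨i, hi⟩ : Mer Ω) * (g i : Mer Ω)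
      have := h.pole_coe_ne_zero ⟨i, hi⟩
      rw [hx]
      field_simp
    have h3 := congrArg (evalRegular hwΩ) h2
    rw [map_mul, hx0, zero_mul, map_mul, map_mul] at h3
    exact (mul_eq_zero.1 h3.symm).resolve_left (hφ _)
  let u : Fin n → Hol Ω := fun i => if (i : ℕ) < r then 0 else g i
  refine hf (((F⁻¹ : GL (Fin n) (Hol Ω)) : Matrix (Fin n) (Fin n) (Hol Ω)).mulVec u) ?_ ?_
  · rw [← toMer_mulVec, hM, Matrix.mulVec_mulVec, Matrix.mul_assoc, toMer_mul_inv, Matrix.mul_one,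
      ← Matrix.mulVec_mulVec]
    refine (congrArg _ (funext fun i => ?_)).trans (Matrix.mulVec_zero _)
    rw [rectDiag_eq_rectDiagonal, rectDiagonal_mulVec hn]
    split_ifs with hi
    · have hu : u ⟨i, hi.trans_le hn⟩ = 0 := if_pos hi
      rw [hu, show ((0 : Hol Ω) : Mer Ω) = 0 from rfl, mul_zero, Pi.zero_apply]
    · rfl
  · have hf' : f = ((F⁻¹ : GL (Fin n) (Hol Ω)) : Matrix (Fin n) (Fin n) (Hol Ω)).mulVec g := by
      simp only [g]
      rw [Matrix.mulVec_mulVec, F.inv_mul, Matrix.one_mulVec]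
    have hug : Hol.eval hwΩ ∘ g = Hol.eval hwΩ ∘ u := by
      funext i
      by_cases hi : (i : ℕ) < r
      · have hu : u i = 0 := if_pos hi
        rw [Function.comp_apply, Function.comp_apply, hg i hi, hu, map_zero]
      · have hu : u i = g i := if_neg hi
        rw [Function.comp_apply, Function.comp_apply, hu]
    funext i
    rw [← Hol.eval_apply hwΩ, ← Hol.eval_apply hwΩ, hf', RingHom.map_mulVec, RingHom.map_mulVec,
      hug]

theorem IsSmithMcMillanForm.zeros_eq (h : IsSmithMcMillanForm M φ ψ) :
    zeros M = {w | w ∈ Ω.carrier ∧ ∃ j, (φ j : Mer Ω).value w = 0} := by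
  have hψ {w : ℂ} (hw : w ∈ Ω.carrier) (hp : w ∉ poles M) (j : Fin r) :
      (ψ j : Mer Ω).value w ≠ 0 := by
    intro h0
    rw [h.poles_eq] at hp
    exact hp ⟨hw, j, h0⟩
  ext w
  constructor
  · rintro (⟨hw, hp, hr⟩ | hw)
    · exact ⟨hw, (h.rank_evalAt_lt_iff hw (hψ hw hp)).1 hr⟩
    · exact ⟨hw.1.1, h.exists_value_eq_zero_of_mem_eigenpoles hw⟩
  · rintro ⟨hw, j, hj⟩
    by_cases hp : w ∈ poles M
    · exact Or.inr (h.mem_eigenpoles hp hj)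
    · exact Or.inl ⟨hw, hp, (h.rank_evalAt_lt_iff hw (hψ hw hp)).2 ⟨j, hj⟩⟩

end SmithMcMillan

end MeroMat

open MeroMat
theorem mainTheorem7 (Ω : Region) (m n r : ℕ)
    (M : Matrix (Fin m) (Fin n) (Mer Ω))
    (N : Matrix (Fin m) (Fin n) (Hol Ω)) (D : Matrix (Fin n) (Fin n) (Hol Ω))
    (φ ψ : Fin r → Hol Ω)
    (hMFD : IsRightCoprimeMFD M N D)
    (hSM : IsSmithMcMillanForm M φ ψ) :
    IsSmithForm N φ ∧
    IsSmithForm D (onesThenReverse n ψ) ∧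
    zeros M = eigenvalues N ∧
    zeros M = {w | w ∈ Ω.carrier ∧ ∃ j, (φ j : Mer Ω).value w = 0} ∧
    (∀ w ∈ zeros M, zeroIndex M w = smithZeroIndex N w) ∧
    poles M = eigenvalues D ∧
    (∀ w ∈ poles M,
      smithZeroIndex D w = List.replicate (n - r) 0 ++ (poleIndex M w).reverse) := by
  have hN := hSM.isSmithForm_numerator hMFD
  have hD := hSM.isSmithForm_denominator hMFD
  have hz := hSM.zeros_eq
  refine ⟨hN, hD, hz.trans hN.eigenvalues_eq.symm, hz, ?_, ?_, ?_⟩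
  · intro w hw
    rw [hz] at hw
    exact hSM.zeroIndex_eq hMFD hw.1
  · rw [hSM.poles_eq, hD.eigenvalues_eq]
    ext w
    exact and_congr_right fun hw =>
      (exists_onesThenReverse_value_eq_zero_iff hSM.le_cols ψ hw).symm
  · intro w hw
    exact hSM.smithZeroIndex_denominator hMFD hw.1
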